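/- Let $N\ge 1$ be an integer and let $M=S^2\subset\mathbb{R}^3$ ($\cong\mathbb{CP}^1$) be the unit sphere with the height function $\mu(p)=\tfrac N2(1+p_3)$ as moment map, moment polytope $P=[0,N]$, longitude $\theta$, and symplectic form $\omega$ equal to $dx\wedge d\theta$, $x=\mu$, off the poles. Let $m\in P$, $\alpha>0$, $S=[m-\alpha,m+\alpha]\cap P$, and let $\psi$ be a smooth function on $P$ whose second derivative is a bump function with support $S$: $\psi''>0$ at the points $x\in P$ with $|x-m|<\alpha$, $\psi''=0$ on the rest of $P$, $\psi''$ is maximal at $m$ and even about $m$. For $s\ge 0$ put $g_s=g_P+s\psi$ with $g_P(x)=\tfrac12x\log x+\tfrac12(N-x)\log(N-x)$, and let $\mathcal P_s=\mathrm{span}_{\mathbb C}\{\partial/\partial w_s\}\subset TM\otimes\mathbb{C}$ be the polarization defined by the holomorphic coordinate $w_s=e^{g_s'(x)+i\theta}$ (extended by $0$ to the pole over $x=0$; at the pole over $x=N$ one uses the coordinate $1/w_s$, extended by $0$). Let $\mathcal P_{\mathbb R}$ be the complexification of $\mathrm{span}_{\mathbb R}\{\partial/\partial\theta\}$, where $\partial/\partial\theta$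 is the generator of rotations (so $\mathcal P_{\mathbb R}=0$ at the poles). Let $\check S$ be the interior of $S$ in $\mathbb R$. Then: 1. Every $\mathcal P_s(p)$ is a Lagrangian subspace of $T_pM\otimes\mathbb{C}$, and for every $p\in M$ the limit $\mathcal P_\infty(p)=\lim_{s\to\infty}\mathcal P_s(p)$ exists, and is unique, in the Lagrangian Grassmannian of $T_pM\otimes\mathbb C$. 2. $\mathcal P_\infty=\mathcal P_{\mathbb R}$ on $\mu^{-1}(\check S)$. 3. On $M\setminus\mu^{-1}(\check S)$ one has $\mathcal P_s=\mathcal P_0$ for all $s\ge0$, and $\mathcal P_\infty=\mathcal P_0$. 4. On $\mu^{-1}(S\cap\partial P)$ one has $\mathcal P_\infty=\mathcal P_{\mathbb R}\oplus\langle \partial/\partial w \mid w=0\rangle_{\mathbb C}$, where, for any $s\geq 0$, $w$ is the holomorphic coordinate ($w_s$ or $1/w_s$) around the pole in question. 5. Write $C^\infty(K,\mathcal P)$ for the space of smooth complex vector fields on $K\subset M$ whose value at each point of $K$ lies in $\mathcal P$. Then $C^\infty(U,\mathcal P_\infty)=C^\infty(U,\mathcal P_{\mathbb R})$ for every open $U\subset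 M$ contained in $\mu^{-1}(S)$, in particular for the interior of $\mu^{-1}(S)$ in $M$ (which contains the poles lying over $S$). On the closed set $\mu^{-1}(S)$ itself, $C^\infty(\mu^{-1}(S),\mathcal P_\infty)$ consists exactly of the elements of $C^\infty(\mu^{-1}(S),\mathcal P_{\mathbb R})$ that vanish on the topological boundary of $\mu^{-1}(S)$ in $M$. -/

import Mathlib

open Set Filter Topology
open scoped Manifold ContDiff TensorProduct NNReal

noncomputable section

namespace ToricSphere

/-! ### The Lagrangian Grassmannian -/

section LagrangianGrassmannian

/-- A subspace is Lagrangian if it equals its own orthogonal complement for the bilinear form. -/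
def IsLagrangian {V : Type*} [AddCommGroup V] [Module ℂ V] (σ : LinearMap.BilinForm ℂ V)
    (L : Submodule ℂ V) : Prop :=
  ∀ v : V, v ∈ L ↔ ∀ u ∈ L, σ u v = 0

/-- The set of all Lagrangian subspaces of `(V, σ)`; here `V` has complex dimension `2 * n`. -/
@[ext]
structure LagrangianGrassmannian {V : Type*} [AddCommGroup V] [Module ℂ V]
    (n : ℕ) (σ : LinearMap.BilinForm ℂ V) where
  space : Submodule ℂ V
  isLagrangian : IsLagrangian σ space

/-- Lagrangian frames: linearly independent `n`-tuples of vectors spanning a Lagrangian subspace. -/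
def LagrangianFrame {V : Type*} [AddCommGroup V] [Module ℂ V]
    (n : ℕ) (σ : LinearMap.BilinForm ℂ V) : Type _ :=
  {b : Fin n → V // LinearIndependent ℂ b ∧ IsLagrangian σ (Submodule.span ℂ (range b))}

/-- The Lagrangian subspace spanned by a Lagrangian frame. -/
def LagrangianFrame.span {V : Type*} [AddCommGroup V] [Module ℂ V]
    {n : ℕ} {σ : LinearMap.BilinForm ℂ V} (b : LagrangianFrame n σ) :
    LagrangianGrassmannian n σ :=
  ⟨Submodule.span ℂ (range b.1), b.2.2⟩

/-- The topology of the space of frames, as a subspace of `Vⁿ`, where the finite-dimensional complex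
vector space `V` carries its canonical topology. -/
instance {V : Type*} [AddCommGroup V] [Module ℂ V]
    (n : ℕ) (σ : LinearMap.BilinForm ℂ V) : TopologicalSpace (LagrangianFrame n σ) :=
  letI : TopologicalSpace V := moduleTopology ℂ V
  inferInstanceAs (TopologicalSpace
    {b : Fin n → V // LinearIndependent ℂ b ∧ IsLagrangian σ (Submodule.span ℂ (range b))})

/-- The topology of the Lagrangian Grassmannian: the quotient topology from the frames. -/
instance {V : Type*} [AddCommGroup V] [Module ℂ V]
    (n : ℕ) (σ : LinearMap.BilinForm ℂ V) : TopologicalSpace (LagrangianGrassmannian n σ) :=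
  TopologicalSpace.coinduced (LagrangianFrame.span (n := n) (σ := σ)) inferInstance

end LagrangianGrassmannian

/-! ### The sphere as a symplectic toric manifold with moment polytope `[0, N]` -/

/-- The unit sphere `S² ⊆ ℝ³`, with Mathlib's manifold structure. -/
abbrev S2 : Type := Metric.sphere (0 : EuclideanSpace ℝ (Fin 3)) 1

/-- The complexified tangent space `T_p S² ⊗ ℂ`. -/
abbrev CTangent (p : S2) : Type := ℂ ⊗[ℝ] TangentSpace (𝓡 2) p

/-- The differential of the inclusion `S² ⊆ ℝ³`, in coordinates of `ℝ³`. -/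
def dincl (p : S2) : TangentSpace (𝓡 2) p →ₗ[ℝ] (Fin 3 → ℝ) :=
  (EuclideanSpace.equiv (Fin 3) ℝ).toLinearMap ∘ₗ
    (mfderiv (𝓡 2) 𝓘(ℝ, EuclideanSpace ℝ (Fin 3))
      (fun q : S2 => (q : EuclideanSpace ℝ (Fin 3))) p).toLinearMap

/-- The moment polytope. -/
def polytope (N : ℕ) : Set ℝ := Icc 0 (N : ℝ)

/-- The moment map: the height function, rescaled so as to have image `[0, N]`. -/
def moment (N : ℕ) (p : S2) : ℝ := N * (1 + p.1 2) / 2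

/-- The symplectic form on `S²` of total area `2πN`. It is `-(N/2)` times the outward oriented
area form `(a, b) ↦ det (p, a, b)`, that is, `dx ∧ dθ` with `x` the moment map and `θ` the
longitude. -/
def symplecticForm (N : ℕ) (p : S2) : LinearMap.BilinForm ℝ (TangentSpace (𝓡 2) p) :=
  LinearMap.mk₂ ℝ
    (fun a b => -((N : ℝ) / 2) * (p.1.ofLp ⬝ᵥ crossProduct (dincl p a) (dincl p b)))
    (fun a b c => by simp only [map_add, LinearMap.add_apply, dotProduct_add, mul_add])
    (fun r a b => by
      simp only [map_smul, LinearMap.smul_apply, dotProduct_smul, smul_eq_mul]; ring)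
    (fun a b c => by simp only [map_add, dotProduct_add, mul_add])
    (fun r a b => by simp only [map_smul, dotProduct_smul, smul_eq_mul]; ring)

/-- The Lagrangian Grassmannian of `T_p S² ⊗ ℂ` with the complexified symplectic form. -/
abbrev LagGr (N : ℕ) (p : S2) : Type :=
  LagrangianGrassmannian 1 ((symplecticForm N p).baseChange ℂ)

/-- A distribution of complex subspaces of the complexified tangent spaces. -/
abbrev Distribution : Type := ∀ p : S2, Submodule ℂ (CTangent p)

/-- The complex-linear extension to `T_p S² ⊗ ℂ` of the differential of a complex function. -/
def cdiff (f : S2 → ℂ) (p : S2) : CTangent p →ₗ[ℂ] ℂ :=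
  let df : TangentSpace (𝓡 2) p →L[ℝ] ℂ := mfderiv (𝓡 2) 𝓘(ℝ, ℂ) f p
  LinearMap.liftBaseChange ℂ df.toLinearMap

/-- The set consisting of the coordinate vector `∂/∂w` at `p`, that is, of the vector `v` with
`dw(v) = 1` and `dw̄(v) = 0`; there is exactly one if `w` is a complex coordinate near `p`. -/
def coordVectors (w : S2 → ℂ) (p : S2) : Set (CTangent p) :=
  {v | cdiff w p v = 1 ∧ cdiff (fun q => star (w q)) p v = 0}

/-- The generator `∂/∂θ` of the rotations about the vertical axis: the set consisting of the
tangent vector which is `(-p₁, p₀, 0)` in `ℝ³`. It is zero at the two poles. -/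
def rotationVectors (p : S2) : Set (TangentSpace (𝓡 2) p) :=
  {v | dincl p v = ![-p.1 1, p.1 0, 0]}

/-- The real toric polarization, the complexification of the real span of `∂/∂θ`. -/
def realPolarization : Distribution := fun p =>
  (Submodule.span ℝ (rotationVectors p)).baseChange ℂ

/-! ### Symplectic potentials and the Kähler polarizations -/

/-- The function `g_P = ∑ (1/2) ℓ log ℓ` for the polytope `[0, N]`. -/
def canonicalPotential (N : ℕ) (x : ℝ) : ℝ :=
  1 / 2 * (x * Real.log x) + 1 / 2 * ((N - x) * Real.log (N - x))

/-- The symplectic potential `g_s = g_P + s ψ`. -/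
def potential (N : ℕ) (ψ : ℝ → ℝ) (s : ℝ) (x : ℝ) : ℝ := canonicalPotential N x + s * ψ x

/-- The function `e^{iθ}`, where `θ` is the longitude; it takes the value `0` at the poles. -/
def phase (p : S2) : ℂ :=
  ((p.1 0 : ℂ) + Complex.I * (p.1 1 : ℂ)) / (‖(p.1 0 : ℂ) + Complex.I * (p.1 1 : ℂ)‖ : ℂ)

/-- The holomorphic coordinate `w_s = e^{y + iθ}`, `y = g_s'(x)`, on the open orbit. At
the pole over `x = 0`, where it extends smoothly by `0`, it has the value `0`. -/
def holCoord (N : ℕ) (ψ : ℝ → ℝ) (s : ℝ) (p : S2) : ℂ :=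
  (Real.exp (deriv (potential N ψ s) (moment N p)) : ℂ) * phase p

/-- The holomorphic coordinate near the point `p` coming from a vertex of `[0, N]`:  `w_s`, which is
a coordinate over `[0, N)`, or, at the pole over `N`, the function `1 / w_s`, which is a
coordinate over `(0, N]` and has the value `0` at that pole. -/
def vertexCoord (N : ℕ) (ψ : ℝ → ℝ) (s : ℝ) (p : S2) : S2 → ℂ :=
  open Classical in
  if moment N p < N then holCoord N ψ s else fun q => (holCoord N ψ s q)⁻¹

/-- The Kähler polarization `P_s`, spanned by `∂/∂w_s`. -/
def kahlerPolarization (N : ℕ) (ψ : ℝ → ℝ) (s : ℝ) : Distribution := fun p =>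
  Submodule.span ℂ (coordVectors (vertexCoord N ψ s p) p)

/-- The span of those coordinate vectors `∂/∂w_j` at `p` for which `w_j` vanishes at `p`, where the
`w_j` are the coordinates near `p` (there is only one of them on a Riemann surface). -/
def vanishingCoordSpan (N : ℕ) (ψ : ℝ → ℝ) (s : ℝ) : Distribution := fun p =>
  Submodule.span ℂ {v | vertexCoord N ψ s p p = 0 ∧ v ∈ coordVectors (vertexCoord N ψ s p) p}

/-- The set `S = [m - α, m + α] ∩ P`. -/
def bumpSet (N : ℕ) (m α : ℝ) : Set ℝ := Icc (m - α) (m + α) ∩ polytope N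

/-- `ψ` is smooth on `P = [0, N]` and `ψ''` is a bump function with support `S`: it is
positive at the points of `P` at distance less than `α` from `m` and zero at the others, it has its
maximum at `m` and it is even about `m`. -/
structure IsOneBump (N : ℕ) (m α : ℝ) (ψ : ℝ → ℝ) : Prop where
  smooth : ContDiffOn ℝ ∞ ψ (polytope N)
  pos : ∀ x ∈ polytope N, |x - m| < α → 0 < iteratedDerivWithin 2 ψ (polytope N) x
  zero : ∀ x ∈ polytope N, α ≤ |x - m| → iteratedDerivWithin 2 ψ (polytope N) x = 0
  max : ∀ x ∈ polytope N,
    iteratedDerivWithin 2 ψ (polytope N) x ≤ iteratedDerivWithin 2 ψ (polytope N) m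
  even : ∀ t : ℝ, m + t ∈ polytope N → m - t ∈ polytope N →
    iteratedDerivWithin 2 ψ (polytope N) (m + t) = iteratedDerivWithin 2 ψ (polytope N) (m - t)

/-! ### Smooth sections -/

/-- `C^∞(P)` over `K`: the smooth complex vector fields on `K` (those with smooth real and imaginary
parts `A` and `B`) whose value at every point of `K` lies in the distribution `P`. -/
def smoothSections (K : Set S2) (P : Distribution) : Set (∀ p : K, CTangent (p : S2)) :=
  {X | ∃ A B : ∀ p : S2, TangentSpace (𝓡 2) p,
    ContMDiffOn (𝓡 2) (𝓡 2).tangent ∞ (fun p => (⟨p, A p⟩ : TangentBundle (𝓡 2) S2)) K ∧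
    ContMDiffOn (𝓡 2) (𝓡 2).tangent ∞ (fun p => (⟨p, B p⟩ : TangentBundle (𝓡 2) S2)) K ∧
    ∀ p : K, X p = (1 : ℂ) ⊗ₜ[ℝ] A p + Complex.I ⊗ₜ[ℝ] B p ∧ X p ∈ P p}

end ToricSphere

end

/-!
Off the poles, `w_s = e^{g_s'(x) + iθ}` gives `dw_s = w_s (g_s'' dx + i dθ)`, so the line spanned by
`∂/∂w_s`, the kernel of the differential of the conjugate of `w_s`, is also spanned by
`∂/∂x - i (g_P'' + s ψ'') ∂/∂θ`. Where `ψ'' > 0` this line tends to the span of `∂/∂θ` as `s → ∞`,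
and where `ψ'' = 0` it does not move. At a pole only the value of `ψ'` at the vertex enters, as a
nonzero scalar factor in the differential of the coordinate, so the line does not move there either.

The computation is done in `ℂ³ ⊇ T_p S² ⊗ ℂ` (`cincl`). By `holCoord_eq` and `holCoord_inv_eq`, the
coordinates `w_s` and `1 / w_s` are the two stereographic coordinates times `e^{± s ψ'(x)}`; this
extends over the poles, and `exists_coordVectors_eq` solves the linear system for `∂/∂w_s`,
uniformly over the sphere without the pole over `N`. All lines in `T_p S² ⊗ ℂ` are Lagrangian
(`isLagrangian_span_singleton`), the Lagrangian Grassmannian is Hausdorff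
(`LagrangianGrassmannian.t2Space`), and lines converge when suitable spanning vectors do
(`tendsto_line`).

For the sections, off the poles a complex tangent vector lies in the real polarization exactly if
its vertical component is zero (`mem_realPolarization_iff`). A section of the limit polarization
satisfies this over the interior of `S`. By continuity along meridians
(`cincl_eq_zero_of_meridian`) it also does so on the boundary circles, where the limit polarization
is transverse to `∂/∂θ`, so the section vanishes there. At a pole, each meridian forces the
component in its own direction to vanish, and two meridians force the whole vector to vanish
(`section_eq_zero_of_pole`). Finally, `μ` is open off the poles (`moment_mem_interior`), and the
poles over `S` are interior points of `μ⁻¹(S)` (`preimage_bumpSet_mem_nhds_of_pole`).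
-/

namespace ToricSphere

/-! ### Lagrangian lines in a symplectic plane -/

section Lines

variable {V : Type*} [AddCommGroup V] [Module ℂ V] {σ : LinearMap.BilinForm ℂ V}

/-- The frame consisting of one nonzero vector, in a plane all of whose lines are Lagrangian. -/
noncomputable def lineFrame (hσ : ∀ u : V, u ≠ 0 → IsLagrangian σ (Submodule.span ℂ {u})) (u : V)
    (hu : u ≠ 0) : LagrangianFrame 1 σ :=
  ⟨fun _ => u, LinearIndependent.of_subsingleton 0 hu, by
    rw [range_const]; exact hσ u hu⟩

theorem lineFrame_span_space (hσ : ∀ u : V, u ≠ 0 → IsLagrangian σ (Submodule.span ℂ {u}))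
    (u : V) (hu : u ≠ 0) :
    (lineFrame hσ u hu).span.space = Submodule.span ℂ {u} := by
  simp [LagrangianFrame.span, lineFrame, range_const]

theorem LagrangianFrame.span_space_eq (b : LagrangianFrame 1 σ) :
    b.span.space = Submodule.span ℂ {b.1 0} := by
  have : range b.1 = {b.1 0} := by
    ext v
    simp [Fin.exists_fin_one, eq_comm]
  simp [LagrangianFrame.span, this]

theorem LagrangianFrame.ne_zero (b : LagrangianFrame 1 σ) : b.1 0 ≠ 0 := b.2.1.ne_zero 0

/-- Every point of the Lagrangian Grassmannian comes from a frame: a Lagrangian subspace contains a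
nonzero vector `u`, and it lies in the orthogonal complement of `u`, which is the line of `u`. -/
theorem LagrangianFrame.span_surjective [Nontrivial V]
    (hσ : ∀ u : V, u ≠ 0 → IsLagrangian σ (Submodule.span ℂ {u})) :
    Function.Surjective (LagrangianFrame.span (n := 1) (σ := σ)) := by
  intro L
  obtain ⟨u, huL, hu⟩ : ∃ u ∈ L.space, u ≠ 0 := by
    by_contra! h
    obtain ⟨v, hv⟩ := exists_ne (0 : V)
    refine hv (h v ((L.isLagrangian v).2 fun u hu => ?_))
    rw [h u hu, map_zero, LinearMap.zero_apply]
  refine ⟨lineFrame hσ u hu, LagrangianGrassmannian.ext ?_⟩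
  rw [lineFrame_span_space]
  refine le_antisymm (by simpa using huL) fun v hv => (hσ u hu v).2 fun u' hu' => ?_
  exact (L.isLagrangian v).1 hv u' ((Submodule.span_singleton_le_iff_mem u _).2 huL hu')

/-- The Lagrangian Grassmannian of a symplectic plane is Hausdorff. Two distinct lines, spanned by
`b₁` and `b₂`, are separated by the continuous function sending the line through `b` to
`‖σ b₂ b‖ / ‖e b‖`, where `e` is any injective linear map to a coordinate space. -/
theorem LagrangianGrassmannian.t2Space [Nontrivial V]
    (hσ : ∀ u : V, u ≠ 0 → IsLagrangian σ (Submodule.span ℂ {u}))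
    {k : ℕ} (e : V →ₗ[ℂ] (Fin k → ℂ)) (he : Function.Injective e) :
    T2Space (LagrangianGrassmannian 1 σ) := by
  have hsurj := LagrangianFrame.span_surjective hσ
  refine ⟨fun L₁ L₂ hne => ?_⟩
  obtain ⟨b₁, rfl⟩ := hsurj L₁
  obtain ⟨b₂, rfl⟩ := hsurj L₂
  let G : LagrangianFrame 1 σ → ℝ := fun b => ‖σ (b₂.1 0) (b.1 0)‖ / ‖e (b.1 0)‖
  let F : LagrangianGrassmannian 1 σ → ℝ := fun L => G (Function.surjInv hsurj L)
  have he0 : ∀ b : LagrangianFrame 1 σ, ‖e (b.1 0)‖ ≠ 0 := fun b => by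
    rw [norm_ne_zero_iff]
    exact fun h => b.ne_zero (he (by rw [h, map_zero]))
  have hG : ∀ b b' : LagrangianFrame 1 σ, b.span = b'.span → G b = G b' := by
    intro b b' h
    have hs : Submodule.span ℂ {b.1 0} = Submodule.span ℂ {b'.1 0} := by
      rw [← b.span_space_eq, ← b'.span_space_eq, h]
    obtain ⟨c, hc⟩ := Submodule.mem_span_singleton.1
      (hs ▸ Submodule.mem_span_singleton_self (b.1 0))
    have hc0 : ‖c‖ ≠ 0 := by
      rw [norm_ne_zero_iff]
      rintro rfl
      exact b.ne_zero (by rw [← hc, zero_smul])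
    simp only [G, ← hc, map_smul, norm_smul, smul_eq_mul, norm_mul]
    exact mul_div_mul_left _ _ hc0
  have hF : ∀ b : LagrangianFrame 1 σ, F b.span = G b := fun b =>
    hG _ _ (Function.surjInv_eq hsurj b.span)
  have hcont : Continuous F := by
    refine continuous_coinduced_dom.2 ?_
    let _ : TopologicalSpace V := moduleTopology ℂ V
    have : IsModuleTopology ℂ V := ⟨rfl⟩
    have hfun : F ∘ LagrangianFrame.span = G := funext hF
    rw [hfun]
    have hval : Continuous (fun b : LagrangianFrame 1 σ => b.1 0) :=
      (continuous_apply (0 : Fin 1)).comp continuous_subtype_val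
    exact (((IsModuleTopology.continuous_of_linearMap (R := ℂ) (σ (b₂.1 0))).comp hval).norm).div
      (((IsModuleTopology.continuous_of_linearMap (R := ℂ) e).comp hval).norm) he0
  refine separated_by_continuous hcont (x := b₁.span) (y := b₂.span) fun h => ?_
  rw [hF, hF] at h
  have h22 : σ (b₂.1 0) (b₂.1 0) = 0 :=
    (hσ _ b₂.ne_zero _).1 (Submodule.mem_span_singleton_self _) _
      (Submodule.mem_span_singleton_self _)
  have h21 : σ (b₂.1 0) (b₁.1 0) = 0 := by
    have : G b₂ = 0 := by simp [G, h22]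
    rw [this] at h
    simpa [G, he0 b₁] using h
  have hmem : b₁.1 0 ∈ Submodule.span ℂ {b₂.1 0} := by
    refine (hσ _ b₂.ne_zero _).2 fun u hu => ?_
    obtain ⟨c, rfl⟩ := Submodule.mem_span_singleton.1 hu
    rw [map_smul, LinearMap.smul_apply, h21, smul_zero]
  refine hne (LagrangianGrassmannian.ext ?_)
  rw [b₁.span_space_eq, b₂.span_space_eq]
  obtain ⟨c, hc⟩ := Submodule.mem_span_singleton.1 hmem
  have hc0 : c ≠ 0 := by
    rintro rfl
    exact b₁.ne_zero (by rw [← hc, zero_smul])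
  rw [← hc]
  exact Submodule.span_singleton_smul_eq (IsUnit.mk0 c hc0) _

/-- If `k → ∞`, the lines spanned by `u₀ + k • u₁` converge to the line spanned by `u₁`. -/
theorem tendsto_line (hσ : ∀ u : V, u ≠ 0 → IsLagrangian σ (Submodule.span ℂ {u}))
    {ι : Type*} {l : Filter ι} {k : ι → ℝ} (hk : Tendsto k l atTop) {u₀ u₁ : V}
    (h : ∀ i, u₀ + (k i : ℂ) • u₁ ≠ 0) (h₁ : u₁ ≠ 0) (P : ι → LagrangianGrassmannian 1 σ)
    (hP : ∀ i, (P i).space = Submodule.span ℂ {u₀ + (k i : ℂ) • u₁})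
    (Q : LagrangianGrassmannian 1 σ) (hQ : Q.space = Submodule.span ℂ {u₁}) :
    Tendsto P l (𝓝 Q) := by
  classical
  -- rescale the spanning vectors so that they converge
  let v : ι → V := fun i => ((k i)⁻¹ : ℂ) • u₀ + u₁
  have hkv : ∀ i, k i ≠ 0 → u₀ + (k i : ℂ) • u₁ = (k i : ℂ) • v i := by
    intro i hi
    have : (k i : ℂ) ≠ 0 := by exact_mod_cast hi
    simp only [v, smul_add, smul_smul, mul_inv_cancel₀ this, one_smul]
  have hv : ∀ i, k i ≠ 0 → v i ≠ 0 := by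
    intro i hi h0
    exact h i (by rw [hkv i hi, h0, smul_zero])
  let w : ι → V := fun i => if k i = 0 then u₁ else v i
  have hw : ∀ i, w i ≠ 0 := by
    intro i
    by_cases hi : k i = 0
    · simpa [w, hi] using h₁
    · simpa [w, hi] using hv i hi
  have hQ' : Q = (lineFrame hσ u₁ h₁).span :=
    LagrangianGrassmannian.ext (by rw [hQ, lineFrame_span_space])
  have hne : ∀ᶠ i in l, k i ≠ 0 := hk.eventually (eventually_ne_atTop 0)
  have hev : (fun i => (lineFrame hσ (w i) (hw i)).span) =ᶠ[l] P := by
    filter_upwards [hne] with i hi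
    refine LagrangianGrassmannian.ext ?_
    have hu : IsUnit (k i : ℂ) := IsUnit.mk0 _ (by exact_mod_cast hi)
    rw [lineFrame_span_space, hP, hkv i hi, Submodule.span_singleton_smul_eq hu]
    simp [w, hi]
  refine Tendsto.congr' hev ?_
  rw [hQ']
  have hspan : Continuous (LagrangianFrame.span (n := 1) (σ := σ)) := continuous_coinduced_rng
  refine (hspan.tendsto _).comp ?_
  let _ : TopologicalSpace V := moduleTopology ℂ V
  have : IsModuleTopology ℂ V := ⟨rfl⟩
  have : ContinuousAdd V := IsModuleTopology.toContinuousAdd ℂ V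
  refine tendsto_subtype_rng.2 (tendsto_pi_nhds.2 fun _ => ?_)
  change Tendsto w l (𝓝 u₁)
  have hvl : Tendsto v l (𝓝 u₁) := by
    have h0 : Tendsto (fun i => ((k i)⁻¹ : ℂ)) l (𝓝 0) := by
      have := (Complex.continuous_ofReal.tendsto 0).comp (tendsto_inv_atTop_zero.comp hk)
      simpa [Function.comp_def] using this
    simpa [v] using (h0.smul_const u₀).add_const u₁
  refine hvl.congr' ?_
  filter_upwards [hne] with i hi
  simp [w, hi]

end Lines

/-! ### The complexified tangent plane inside `ℂ³` -/

/-- The complexification of the differential of the inclusion `S² ⊆ ℝ³`. -/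
noncomputable def cincl (p : S2) : CTangent p →ₗ[ℂ] (Fin 3 → ℂ) :=
  LinearMap.liftBaseChange ℂ ((Complex.ofRealCLM.toLinearMap.compLeft (Fin 3)) ∘ₗ dincl p)

theorem cincl_tmul (p : S2) (c : ℂ) (v : TangentSpace (𝓡 2) p) (i : Fin 3) :
    cincl p (c ⊗ₜ[ℝ] v) i = c * (dincl p v i : ℂ) := by
  simp [cincl, LinearMap.liftBaseChange_tmul]

instance : Fact (Module.finrank ℝ (EuclideanSpace ℝ (Fin 3)) = 2 + 1) := ⟨by simp⟩

theorem injective_mfderiv_coe (p : S2) : Function.Injective (mfderiv (𝓡 2)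
    𝓘(ℝ, EuclideanSpace ℝ (Fin 3)) (fun q : S2 => (q : EuclideanSpace ℝ (Fin 3))) p) := by
  convert! injective_mvfderiv_subtypeVal_sphere p

theorem range_mfderiv_coe (p : S2) : (mfderiv (𝓡 2)
    𝓘(ℝ, EuclideanSpace ℝ (Fin 3)) (fun q : S2 => (q : EuclideanSpace ℝ (Fin 3))) p).range =
      (ℝ ∙ (p : EuclideanSpace ℝ (Fin 3)))ᗮ := by
  convert! range_mvfderiv_subtypeVal p

theorem dincl_injective (p : S2) : Function.Injective (dincl p) := by
  intro v w h
  exact injective_mfderiv_coe p ((EuclideanSpace.equiv (Fin 3) ℝ).injective h)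

theorem sum_sq (p : S2) : p.1 0 ^ 2 + p.1 1 ^ 2 + p.1 2 ^ 2 = 1 := by
  have h := EuclideanSpace.norm_sq_eq p.1
  rw [norm_eq_of_mem_sphere p, Fin.sum_univ_three] at h
  simp only [Real.norm_eq_abs, sq_abs] at h
  linarith

/-- The tangent plane at `p` is the orthogonal complement of `p` in `ℝ³`. -/
theorem exists_dincl_eq_iff (p : S2) (a : Fin 3 → ℝ) :
    (∃ v, dincl p v = a) ↔ p.1 0 * a 0 + p.1 1 * a 1 + p.1 2 * a 2 = 0 := by
  have hr := range_mfderiv_coe p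
  have h1 : WithLp.toLp 2 a ∈ (ℝ ∙ (p : EuclideanSpace ℝ (Fin 3)))ᗮ ↔
      p.1 0 * a 0 + p.1 1 * a 1 + p.1 2 * a 2 = 0 := by
    rw [Submodule.mem_orthogonal_singleton_iff_inner_right]
    simp [PiLp.inner_apply, Fin.sum_univ_three, mul_comm]
  rw [← h1, ← hr]
  constructor
  · rintro ⟨v, rfl⟩
    exact ⟨v, rfl⟩
  · rintro ⟨v, hv⟩
    exact ⟨v, congrArg (EuclideanSpace.equiv (Fin 3) ℝ) hv⟩

theorem inner_dincl (p : S2) (v : TangentSpace (𝓡 2) p) :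
    p.1 0 * dincl p v 0 + p.1 1 * dincl p v 1 + p.1 2 * dincl p v 2 = 0 :=
  (exists_dincl_eq_iff p _).1 ⟨v, rfl⟩

/-- Every complex tangent vector is `A + iB` with `A`, `B` real. -/
theorem exists_re_im (p : S2) (X : CTangent p) : ∃ A B : TangentSpace (𝓡 2) p,
    X = (1 : ℂ) ⊗ₜ[ℝ] A + Complex.I ⊗ₜ[ℝ] B := by
  induction X using TensorProduct.induction_on with
  | zero => exact ⟨0, 0, by simp⟩
  | tmul c v =>
    refine ⟨c.re • v, c.im • v, ?_⟩
    rw [← TensorProduct.smul_tmul, ← TensorProduct.smul_tmul, ← TensorProduct.add_tmul]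
    congr 1
    conv_lhs => rw [← Complex.re_add_im c]
    simp [Complex.real_smul]
  | add X Y hX hY =>
    obtain ⟨A, B, rfl⟩ := hX
    obtain ⟨A', B', rfl⟩ := hY
    exact ⟨A + A', B + B', by rw [TensorProduct.tmul_add, TensorProduct.tmul_add]; abel⟩

theorem cincl_re_im (p : S2) (A B : TangentSpace (𝓡 2) p) (i : Fin 3) :
    cincl p ((1 : ℂ) ⊗ₜ[ℝ] A + Complex.I ⊗ₜ[ℝ] B) i = ⟨dincl p A i, dincl p B i⟩ := by
  rw [map_add, Pi.add_apply, cincl_tmul, cincl_tmul]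
  apply Complex.ext <;> simp

theorem cincl_injective (p : S2) : Function.Injective (cincl p) := by
  rw [injective_iff_map_eq_zero]
  intro X hX
  obtain ⟨A, B, rfl⟩ := exists_re_im p X
  have h : ∀ i, dincl p A i = 0 ∧ dincl p B i = 0 := fun i => by
    have := congrFun hX i
    rw [cincl_re_im] at this
    exact ⟨congrArg Complex.re this, congrArg Complex.im this⟩
  have hA : A = 0 := dincl_injective p (by rw [map_zero]; exact funext fun i => (h i).1)
  have hB : B = 0 := dincl_injective p (by rw [map_zero]; exact funext fun i => (h i).2)
  simp [hA, hB]

theorem exists_cincl_eq (p : S2) (a : Fin 3 → ℂ)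
    (ha : (p.1 0 : ℂ) * a 0 + (p.1 1 : ℂ) * a 1 + (p.1 2 : ℂ) * a 2 = 0) :
    ∃ X, cincl p X = a := by
  have hre := congrArg Complex.re ha
  have him := congrArg Complex.im ha
  simp at hre him
  obtain ⟨A, hA⟩ := (exists_dincl_eq_iff p (fun i => (a i).re)).2 hre
  obtain ⟨B, hB⟩ := (exists_dincl_eq_iff p (fun i => (a i).im)).2 him
  refine ⟨(1 : ℂ) ⊗ₜ[ℝ] A + Complex.I ⊗ₜ[ℝ] B, funext fun i => ?_⟩
  rw [cincl_re_im, hA, hB]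

theorem inner_cincl (p : S2) (X : CTangent p) :
    (p.1 0 : ℂ) * cincl p X 0 + (p.1 1 : ℂ) * cincl p X 1 + (p.1 2 : ℂ) * cincl p X 2 = 0 := by
  obtain ⟨A, B, rfl⟩ := exists_re_im p X
  simp only [cincl_re_im]
  apply Complex.ext
  · simpa using inner_dincl p A
  · simpa using inner_dincl p B

instance (p : S2) : Nontrivial (CTangent p) := by
  rw [nontrivial_iff]
  by_contra! h
  have h0 : ∀ X : CTangent p, cincl p X = 0 := fun X => by rw [h X 0, map_zero]
  obtain ⟨X, hX⟩ := exists_cincl_eq p ![-p.1 1, p.1 0, 0] (by simp; ring)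
  obtain ⟨Y, hY⟩ := exists_cincl_eq p ![0, -p.1 2, p.1 1] (by simp; ring)
  rw [h0] at hX hY
  have e0 := congrFun hX 0
  have e1 := congrFun hX 1
  have e2 := congrFun hY 1
  simp at e0 e1 e2
  have := sum_sq p
  have e1' : p.1 0 = 0 := Complex.ofReal_eq_zero.1 e1.symm
  rw [e1', e0, e2] at this
  norm_num at this

theorem symplecticForm_baseChange (N : ℕ) (p : S2) (X Y : CTangent p) :
    (symplecticForm N p).baseChange ℂ X Y = -((N : ℂ) / 2) *
      ((p.1 0 : ℂ) * (cincl p X 1 * cincl p Y 2 - cincl p X 2 * cincl p Y 1) +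
        (p.1 1 : ℂ) * (cincl p X 2 * cincl p Y 0 - cincl p X 0 * cincl p Y 2) +
        (p.1 2 : ℂ) * (cincl p X 0 * cincl p Y 1 - cincl p X 1 * cincl p Y 0)) := by
  obtain ⟨A, B, rfl⟩ := exists_re_im p X
  obtain ⟨A', B', rfl⟩ := exists_re_im p Y
  simp only [map_add, LinearMap.add_apply, LinearMap.BilinForm.baseChange_tmul, Pi.add_apply,
    cincl_tmul, symplecticForm, LinearMap.mk₂_apply, cross_apply, dotProduct, Fin.sum_univ_three,
    Matrix.cons_val_zero, Matrix.cons_val_one, Matrix.cons_val, Complex.real_smul]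
  push_cast
  ring

/-- Complex lines in the complexified tangent plane are Lagrangian: for vectors orthogonal to the
unit vector `p`, the cross product is a multiple of `p`, so it vanishes with its `p`-component. -/
theorem isLagrangian_span_singleton (N : ℕ) (hN : 0 < N) (p : S2) (u : CTangent p) (hu : u ≠ 0) :
    IsLagrangian ((symplecticForm N p).baseChange ℂ) (Submodule.span ℂ {u}) := by
  have hN' : -((N : ℂ) / 2) ≠ 0 := by
    have : (N : ℂ) ≠ 0 := by exact_mod_cast hN.ne'
    simpa using this
  intro v
  constructor
  · intro hv u' hu'
    obtain ⟨c, rfl⟩ := Submodule.mem_span_singleton.1 hv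
    obtain ⟨d, rfl⟩ := Submodule.mem_span_singleton.1 hu'
    rw [symplecticForm_baseChange]
    simp only [map_smul, Pi.smul_apply, smul_eq_mul]
    ring
  · intro h
    have h0 := h u (Submodule.mem_span_singleton_self u)
    rw [symplecticForm_baseChange, mul_eq_zero, or_iff_right hN'] at h0
    have hpu := inner_cincl p u
    have hpv := inner_cincl p v
    have hp : (p.1 0 : ℂ) ^ 2 + (p.1 1 : ℂ) ^ 2 + (p.1 2 : ℂ) ^ 2 = 1 := by
      have := congrArg Complex.ofReal (sum_sq p)
      push_cast at this
      exact this
    have hui : ∃ i, cincl p u i ≠ 0 := by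
      by_contra! hall
      exact hu (cincl_injective p (by rw [map_zero]; exact funext hall))
    generalize ha : cincl p u = a at *
    generalize hb : cincl p v = b at *
    generalize (p.1 0 : ℂ) = x at *
    generalize (p.1 1 : ℂ) = y at *
    generalize (p.1 2 : ℂ) = z at *
    -- by the triple product identities, `a × b = (p · (a × b)) p = 0`
    have c0 : a 1 * b 2 = a 2 * b 1 := by
      linear_combination (-(a 1 * b 2 - a 2 * b 1)) * hp + x * h0
        - (y * b 2 - z * b 1) * hpu * (-1) + (y * a 2 - z * a 1) * hpv * (-1)
    have c1 : a 2 * b 0 = a 0 * b 2 := by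
      linear_combination (-(a 2 * b 0 - a 0 * b 2)) * hp + y * h0
        - (z * b 0 - x * b 2) * hpu * (-1) + (z * a 0 - x * a 2) * hpv * (-1)
    have c2 : a 0 * b 1 = a 1 * b 0 := by
      linear_combination (-(a 0 * b 1 - a 1 * b 0)) * hp + z * h0
        - (x * b 1 - y * b 0) * hpu * (-1) + (x * a 1 - y * a 0) * hpv * (-1)
    obtain ⟨i, hi⟩ := hui
    refine Submodule.mem_span_singleton.2 ⟨b i / a i, cincl_injective p ?_⟩
    rw [map_smul, ha, hb]
    funext j
    rw [Pi.smul_apply, smul_eq_mul, div_mul_eq_mul_div, div_eq_iff hi]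
    fin_cases i <;> fin_cases j <;> simp only [Fin.zero_eta, Fin.mk_one, Fin.reduceFinMk] <;>
      first
        | ring1
        | linear_combination c0
        | linear_combination -c0
        | linear_combination c1
        | linear_combination -c1
        | linear_combination c2
        | linear_combination -c2

/-! ### The holomorphic coordinates in terms of stereographic coordinates -/

section Coordinates

variable {N : ℕ} {m α : ℝ} {ψ : ℝ → ℝ}

theorem abs_height_le (p : S2) : -1 ≤ p.1 2 ∧ p.1 2 ≤ 1 := by
  have := sum_sq p
  constructor <;> nlinarith [sq_nonneg (p.1 0), sq_nonneg (p.1 1)]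

theorem moment_mem_polytope (N : ℕ) (p : S2) : moment N p ∈ polytope N := by
  have h := abs_height_le p
  have hN : (0 : ℝ) ≤ N := N.cast_nonneg
  constructor
  · unfold moment
    have : 0 ≤ N * (1 + p.1 2) := mul_nonneg hN (by linarith)
    linarith
  · unfold moment
    nlinarith

theorem moment_lt_iff (hN : 0 < N) (p : S2) : moment N p < N ↔ p.1 2 < 1 := by
  have hN' : (0 : ℝ) < N := by exact_mod_cast hN
  unfold moment
  constructor <;> intro h <;> nlinarith

theorem moment_pos_iff (hN : 0 < N) (p : S2) : 0 < moment N p ↔ -1 < p.1 2 := by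
  have hN' : (0 : ℝ) < N := by exact_mod_cast hN
  unfold moment
  constructor <;> intro h <;> nlinarith

theorem moment_mem_Ioo_iff (hN : 0 < N) (p : S2) :
    moment N p ∈ Ioo 0 (N : ℝ) ↔ -1 < p.1 2 ∧ p.1 2 < 1 := by
  rw [mem_Ioo, moment_pos_iff hN, moment_lt_iff hN]

theorem polytope_mem_nhds {x : ℝ} (hx : x ∈ Ioo 0 (N : ℝ)) : polytope N ∈ 𝓝 x :=
  Icc_mem_nhds hx.1 hx.2

theorem IsOneBump.second_nonneg (hψ : IsOneBump N m α ψ) {x : ℝ} (hx : x ∈ polytope N) :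
    0 ≤ iteratedDerivWithin 2 ψ (polytope N) x := by
  rcases lt_or_ge |x - m| α with h | h
  · exact (hψ.pos x hx h).le
  · exact (hψ.zero x hx h).ge

/-- The derivative of `ψ` on `[0, N]` extends to a continuous function on `ℝ`; its derivative in the
interior of `[0, N]` is the second derivative of `ψ`. -/
theorem IsOneBump.exists_extension (hN : 0 < N) (hψ : IsOneBump N m α ψ) :
    ∃ Ψ : ℝ → ℝ, Continuous Ψ ∧ (∀ x ∈ Ioo 0 (N : ℝ), HasDerivAt ψ (Ψ x) x) ∧
      ∀ x ∈ Ioo 0 (N : ℝ), HasDerivAt Ψ (iteratedDerivWithin 2 ψ (polytope N) x) x := by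
  have hN' : (0 : ℝ) < N := by exact_mod_cast hN
  have hu : UniqueDiffOn ℝ (polytope N) := uniqueDiffOn_Icc hN'
  have hd : ContDiffOn ℝ ∞ (derivWithin ψ (polytope N)) (polytope N) :=
    hψ.smooth.derivWithin hu (by simp)
  let Ψ : ℝ → ℝ := IccExtend hN'.le ((polytope N).domRestrict (derivWithin ψ (polytope N)))
  have hΨ : ∀ x ∈ polytope N, Ψ x = derivWithin ψ (polytope N) x := fun x hx =>
    IccExtend_of_mem hN'.le _ hx
  refine ⟨Ψ, (continuousOn_iff_continuous_domRestrict.1 hd.continuousOn).Icc_extend', ?_, ?_⟩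
  · intro x hx
    have hn := polytope_mem_nhds hx
    rw [hΨ x (mem_of_mem_nhds hn), derivWithin_of_mem_nhds hn]
    exact ((hψ.smooth.contDiffAt hn).differentiableAt (by simp)).hasDerivAt
  · intro x hx
    have hn := polytope_mem_nhds hx
    have hx' := mem_of_mem_nhds hn
    have he : Ψ =ᶠ[𝓝 x] derivWithin ψ (polytope N) := by
      filter_upwards [hn] with y hy using hΨ y hy
    have h2 : iteratedDerivWithin 2 ψ (polytope N) x =
        derivWithin (derivWithin ψ (polytope N)) (polytope N) x := by
      rw [iteratedDerivWithin_succ, iteratedDerivWithin_one]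
    rw [h2, derivWithin_of_mem_nhds hn]
    exact (((hd.contDiffAt hn).differentiableAt (by simp)).hasDerivAt).congr_of_eventuallyEq he

theorem hasDerivAt_canonicalPotential {x : ℝ} (hx : x ∈ Ioo 0 (N : ℝ)) :
    HasDerivAt (canonicalPotential N) (1 / 2 * Real.log x - 1 / 2 * Real.log (N - x)) x := by
  have h1 : HasDerivAt (fun x => x * Real.log x) (Real.log x + 1) x :=
    Real.hasDerivAt_mul_log hx.1.ne'
  have h2 : HasDerivAt (fun x : ℝ => (N - x) * Real.log (N - x))
      ((Real.log (N - x) + 1) * (-1)) x :=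
    HasDerivAt.comp x (h₂ := fun y => y * Real.log y)
      (Real.hasDerivAt_mul_log (sub_pos.2 hx.2).ne')
      ((hasDerivAt_id x).const_sub (N : ℝ))
  exact ((h1.const_mul (1 / 2)).add (h2.const_mul (1 / 2))).congr_deriv (by ring)

theorem deriv_potential {x d : ℝ} (hx : x ∈ Ioo 0 (N : ℝ)) (hd : HasDerivAt ψ d x) (s : ℝ) :
    deriv (potential N ψ s) x = 1 / 2 * Real.log x - 1 / 2 * Real.log (N - x) + s * d :=
  ((hasDerivAt_canonicalPotential hx).add (hd.const_mul s)).deriv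

/-- `e^{g_P'(x)}` is the ratio of the radius of the circle of latitude to `1 - p₂`. -/
theorem exp_canonicalPotential_deriv (hN : 0 < N) (p : S2) (hp : -1 < p.1 2 ∧ p.1 2 < 1) :
    Real.exp (1 / 2 * Real.log (moment N p) - 1 / 2 * Real.log (N - moment N p)) =
      ‖(p.1 0 : ℂ) + Complex.I * (p.1 1 : ℂ)‖ / (1 - p.1 2) := by
  have hx := (moment_mem_Ioo_iff hN p).2 hp
  have hN' : (0 : ℝ) < N := by exact_mod_cast hN
  have ht : 0 < 1 - p.1 2 := by linarith
  have h1 : ‖(p.1 0 : ℂ) + Complex.I * (p.1 1 : ℂ)‖ ^ 2 = (1 - p.1 2) * (1 + p.1 2) := by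
    rw [Complex.sq_norm, mul_comm, Complex.normSq_add_mul_I]
    linear_combination sum_sq p
  refine (sq_eq_sq₀ (Real.exp_pos _).le (by positivity)).1 ?_
  rw [div_pow, h1, ← Real.exp_nat_mul]
  have h2 : ((2 : ℕ) : ℝ) * (1 / 2 * Real.log (moment N p) - 1 / 2 * Real.log (N - moment N p)) =
      Real.log (moment N p / (N - moment N p)) := by
    rw [Real.log_div hx.1.ne' (sub_pos.2 hx.2).ne']
    push_cast
    ring
  rw [h2, Real.exp_log (div_pos hx.1 (sub_pos.2 hx.2))]
  have h3 : (N : ℝ) - moment N p = N * (1 - p.1 2) / 2 := by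
    unfold moment; ring
  rw [h3]
  unfold moment
  field_simp

/-- The function `p₀ + i p₁` vanishes exactly at the two poles. -/
theorem horizontal_eq_zero_iff (p : S2) :
    (p.1 0 : ℂ) + Complex.I * (p.1 1 : ℂ) = 0 ↔ ¬(-1 < p.1 2 ∧ p.1 2 < 1) := by
  have hs := sum_sq p
  have hb := abs_height_le p
  constructor
  · intro h
    have h0 := congrArg Complex.re h
    have h1 := congrArg Complex.im h
    simp at h0 h1
    rintro ⟨ha, hb⟩
    rw [h0, h1] at hs
    nlinarith
  · intro h
    have h2 : p.1 2 ^ 2 = 1 := by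
      by_cases ha : -1 < p.1 2
      · have : p.1 2 = 1 := le_antisymm hb.2 (not_lt.1 fun h' => h ⟨ha, h'⟩)
        rw [this]; norm_num
      · have : p.1 2 = -1 := le_antisymm (not_lt.1 ha) hb.1
        rw [this]; norm_num
    have h0 : p.1 0 = 0 := by nlinarith [sq_nonneg (p.1 0), sq_nonneg (p.1 1)]
    have h1 : p.1 1 = 0 := by nlinarith [sq_nonneg (p.1 0), sq_nonneg (p.1 1)]
    simp [h0, h1]

/-- Away from the pole over `N`, the coordinate `w_s` is the stereographic coordinate
`(p₀ + i p₁) / (1 - p₂)` times `e^{s ψ'}`. -/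
theorem holCoord_eq (hN : 0 < N) {Ψ : ℝ → ℝ}
    (hΨ : ∀ x ∈ Ioo 0 (N : ℝ), HasDerivAt ψ (Ψ x) x) (s : ℝ) (p : S2) (hp : p.1 2 < 1) :
    holCoord N ψ s p = ((Real.exp (s * Ψ (N * (1 + p.1 2) / 2)) / (1 - p.1 2) : ℝ) : ℂ) *
      ((p.1 0 : ℂ) + Complex.I * (p.1 1 : ℂ)) := by
  by_cases h : -1 < p.1 2 ∧ p.1 2 < 1
  · have hx := (moment_mem_Ioo_iff hN p).2 h
    have hz : (p.1 0 : ℂ) + Complex.I * (p.1 1 : ℂ) ≠ 0 := by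
      rw [Ne, horizontal_eq_zero_iff]
      exact not_not.2 h
    have hz' : (‖(p.1 0 : ℂ) + Complex.I * (p.1 1 : ℂ)‖ : ℂ) ≠ 0 := by
      exact_mod_cast norm_ne_zero_iff.2 hz
    have ht : (1 - p.1 2 : ℂ) ≠ 0 := by
      have := Complex.ofReal_ne_zero.2 (show (1 - p.1 2 : ℝ) ≠ 0 by linarith [h.1, h.2])
      push_cast at this
      exact this
    rw [holCoord, phase, deriv_potential hx (hΨ _ hx), Real.exp_add,
      exp_canonicalPotential_deriv hN p h]
    change _ = ((Real.exp (s * Ψ (moment N p)) / (1 - p.1 2) : ℝ) : ℂ) * _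
    push_cast
    field_simp
  · -- at the pole `g_s'` has a junk value, but the phase is zero there
    have hz := (horizontal_eq_zero_iff p).2 h
    rw [holCoord, phase, hz]
    simp

/-- Away from the pole over `0`, the coordinate `1 / w_s` is the opposite stereographic coordinate
times `e^{-s ψ'}`. -/
theorem holCoord_inv_eq (hN : 0 < N) {Ψ : ℝ → ℝ}
    (hΨ : ∀ x ∈ Ioo 0 (N : ℝ), HasDerivAt ψ (Ψ x) x) (s : ℝ) (p : S2) (hp : -1 < p.1 2) :
    (holCoord N ψ s p)⁻¹ = ((Real.exp (-(s * Ψ (N * (1 + p.1 2) / 2))) / (1 + p.1 2) : ℝ) : ℂ) *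
      ((p.1 0 : ℂ) - Complex.I * (p.1 1 : ℂ)) := by
  by_cases h : -1 < p.1 2 ∧ p.1 2 < 1
  · have hz : (p.1 0 : ℂ) + Complex.I * (p.1 1 : ℂ) ≠ 0 := by
      rw [Ne, horizontal_eq_zero_iff]
      exact not_not.2 h
    have ht : (1 - p.1 2 : ℂ) ≠ 0 := by
      have := Complex.ofReal_ne_zero.2 (show (1 - p.1 2 : ℝ) ≠ 0 by linarith [h.1, h.2])
      push_cast at this
      exact this
    have ht' : (1 + p.1 2 : ℂ) ≠ 0 := by
      have := Complex.ofReal_ne_zero.2 (show (1 + p.1 2 : ℝ) ≠ 0 by linarith [h.1, h.2])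
      push_cast at this
      exact this
    have hs := congrArg Complex.ofReal (sum_sq p)
    push_cast at hs
    rw [holCoord_eq hN hΨ s p h.2, Real.exp_neg]
    have he : (Complex.exp ((s * Ψ (N * (1 + p.1 2) / 2) : ℝ) : ℂ)) ≠ 0 := Complex.exp_ne_zero _
    push_cast at he ⊢
    field_simp
    linear_combination (-(1 : ℂ)) * hs + (p.1 1 : ℂ) ^ 2 * Complex.I_sq
  · have hz := (horizontal_eq_zero_iff p).2 h
    have h0 := congrArg Complex.re hz
    have h1 := congrArg Complex.im hz
    simp at h0 h1
    rw [holCoord, phase, hz, h0, h1]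
    simp

/-! ### Differentials of the coordinates -/

/-- The differential of a function given near `p` by a function on the ambient space. -/
theorem cdiff_eq {f : S2 → ℂ} {F : EuclideanSpace ℝ (Fin 3) → ℂ}
    {F' : EuclideanSpace ℝ (Fin 3) →L[ℝ] ℂ} {p : S2} (hf : f =ᶠ[𝓝 p] fun q => F q.1)
    (hF : HasFDerivAt F F' p.1) {c : Fin 3 → ℂ}
    (hc : ∀ v, F' v = c 0 * (v 0 : ℂ) + c 1 * (v 1 : ℂ) + c 2 * (v 2 : ℂ)) (X : CTangent p) :
    cdiff f p X = c 0 * cincl p X 0 + c 1 * cincl p X 1 + c 2 * cincl p X 2 := by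
  have hι : HasMFDerivAt (𝓡 2) 𝓘(ℝ, EuclideanSpace ℝ (Fin 3))
      (fun q : S2 => (q : EuclideanSpace ℝ (Fin 3))) p (mfderiv (𝓡 2)
        𝓘(ℝ, EuclideanSpace ℝ (Fin 3)) (fun q : S2 => (q : EuclideanSpace ℝ (Fin 3))) p) :=
    ((contMDiff_coe_sphere p).mdifferentiableAt one_ne_zero).hasMFDerivAt
  have hd : mfderiv (𝓡 2) 𝓘(ℝ, ℂ) f p = F'.comp (mfderiv (𝓡 2)
        𝓘(ℝ, EuclideanSpace ℝ (Fin 3)) (fun q : S2 => (q : EuclideanSpace ℝ (Fin 3))) p) := by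
    rw [hf.mfderiv_eq]
    exact (hF.hasMFDerivAt.comp p hι).mfderiv
  have hv : ∀ A : TangentSpace (𝓡 2) p, mfderiv (𝓡 2) 𝓘(ℝ, ℂ) f p A =
      c 0 * (dincl p A 0 : ℂ) + c 1 * (dincl p A 1 : ℂ) + c 2 * (dincl p A 2 : ℂ) := by
    intro A
    rw [hd]
    exact hc _
  obtain ⟨A, B, rfl⟩ := exists_re_im p X
  have e1 : ∀ (a : ℂ) (A : TangentSpace (𝓡 2) p), cdiff f p (a ⊗ₜ[ℝ] A) =
      a * (c 0 * (dincl p A 0 : ℂ) + c 1 * (dincl p A 1 : ℂ) + c 2 * (dincl p A 2 : ℂ)) := by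
    intro a A
    rw [← hv, cdiff]
    exact LinearMap.liftBaseChange_tmul ..
  rw [map_add, e1, e1, map_add]
  simp only [Pi.add_apply, cincl_tmul]
  ring

theorem cdiff_star_eq {f : S2 → ℂ} {F : EuclideanSpace ℝ (Fin 3) → ℂ}
    {F' : EuclideanSpace ℝ (Fin 3) →L[ℝ] ℂ} {p : S2} (hf : f =ᶠ[𝓝 p] fun q => F q.1)
    (hF : HasFDerivAt F F' p.1) {c : Fin 3 → ℂ}
    (hc : ∀ v, F' v = c 0 * (v 0 : ℂ) + c 1 * (v 1 : ℂ) + c 2 * (v 2 : ℂ)) (X : CTangent p) :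
    cdiff (fun q => star (f q)) p X =
      star (c 0) * cincl p X 0 + star (c 1) * cincl p X 1 + star (c 2) * cincl p X 2 := by
  refine cdiff_eq (F := fun x => star (F x)) (c := fun i => star (c i))
    (F' := (Complex.conjCLE : ℂ →L[ℝ] ℂ).comp F') ?_ ?_ ?_ X
  · filter_upwards [hf] with q hq
    rw [hq]
  · exact (Complex.conjCLE : ℂ →L[ℝ] ℂ).hasFDerivAt.comp p.1 hF
  · intro v
    simp [hc]

/-- The real linear form `v ↦ v₀ + a v₁` on `ℝ³`. -/
noncomputable def horizontalForm (a : ℂ) : EuclideanSpace ℝ (Fin 3) →L[ℝ] ℂ :=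
  Complex.ofRealCLM.comp (EuclideanSpace.proj 0) +
    a • Complex.ofRealCLM.comp (EuclideanSpace.proj 1)

theorem horizontalForm_apply (a : ℂ) (v : EuclideanSpace ℝ (Fin 3)) :
    horizontalForm a v = (v 0 : ℂ) + a * (v 1 : ℂ) := by
  simp [horizontalForm]

theorem hasFDerivAt_mul_horizontal (a : ℂ) {G : ℝ → ℝ} {g : ℝ} {x : EuclideanSpace ℝ (Fin 3)}
    (hG : HasDerivAt G g (x 2)) :
    ∃ F' : EuclideanSpace ℝ (Fin 3) →L[ℝ] ℂ,
      HasFDerivAt (fun y : EuclideanSpace ℝ (Fin 3) => (G (y 2) : ℂ) * ((y 0 : ℂ) + a * (y 1 : ℂ)))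
        F' x ∧ ∀ v, F' v = (G (x 2) : ℂ) * (v 0 : ℂ) + (a * (G (x 2) : ℂ)) * (v 1 : ℂ) +
          (((x 0 : ℂ) + a * (x 1 : ℂ)) * (g : ℂ)) * (v 2 : ℂ) := by
  have h1 : HasFDerivAt (fun y : EuclideanSpace ℝ (Fin 3) => (G (y 2) : ℂ)) _ x :=
    Complex.ofRealCLM.hasFDerivAt.comp x
      (hG.comp_hasFDerivAt x (EuclideanSpace.proj (𝕜 := ℝ) (2 : Fin 3)).hasFDerivAt)
  have h2 := h1.mul (horizontalForm a).hasFDerivAt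
  refine ⟨_, h2.congr_of_eventuallyEq (Eventually.of_forall fun y => ?_), fun v => ?_⟩
  · simp [horizontalForm_apply]
  · simp [horizontalForm_apply]
    ring

/-- Where the form `y₀ + a y₁` vanishes, continuity of the other factor suffices. -/
theorem hasFDerivAt_mul_horizontal_of_eq_zero (a : ℂ) {G : ℝ → ℝ}
    {x : EuclideanSpace ℝ (Fin 3)} (hG : ContinuousAt G (x 2))
    (hx : (x 0 : ℂ) + a * (x 1 : ℂ) = 0) :
    HasFDerivAt (fun y : EuclideanSpace ℝ (Fin 3) => (G (y 2) : ℂ) * ((y 0 : ℂ) + a * (y 1 : ℂ)))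
      ((G (x 2) : ℂ) • horizontalForm a) x := by
  have hc : ContinuousAt (fun y : EuclideanSpace ℝ (Fin 3) => (G (y 2) : ℂ)) x :=
    Complex.continuous_ofReal.continuousAt.comp
      (ContinuousAt.comp (f := fun y : EuclideanSpace ℝ (Fin 3) => y 2) hG
        (EuclideanSpace.proj (𝕜 := ℝ) (2 : Fin 3)).continuous.continuousAt)
  have h1 : (fun y : EuclideanSpace ℝ (Fin 3) => (G (y 2) : ℂ) - (G (x 2) : ℂ)) =o[𝓝 x]
      fun _ => (1 : ℝ) :=
    (Asymptotics.isLittleO_one_iff ℝ).2 (by simpa using hc.tendsto.sub_const (G (x 2) : ℂ))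
  have h2 : (fun y => horizontalForm a (y - x)) =O[𝓝 x] fun y => y - x :=
    (horizontalForm a).isBigO_comp _ _
  have h3 := h1.mul_isBigO h2.norm_right
  refine .of_isLittleO ?_
  refine (h3.congr' (Eventually.of_forall fun y => ?_)
    (Eventually.of_forall fun y => one_mul _)).of_norm_right
  simp only [horizontalForm_apply, map_sub, smul_apply, smul_eq_mul]
  linear_combination ((G (x 2) : ℂ) - (G (y 2) : ℂ)) * hx

end Coordinates

section CoordinateVectors

variable {N : ℕ} {m α : ℝ} {ψ : ℝ → ℝ}

/-! ### The coordinate vectors -/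

/-- The linear system for the coordinate vector, in the unknowns `A = a₀ + i a₁`, `B = a₀ - i a₁`
and `a₂`; here `t = 1 - p₂`, while `ζ`, `ζ'` are `p₀ ± i p₁`. -/
theorem coordinate_system_iff {t e k ζ ζ' A B c : ℂ} (ht : t ≠ 0) (he : e ≠ 0)
    (hD : 1 + k * (2 - t) ≠ 0) (hζ : ζ * ζ' = t * (2 - t))
    (hC : ζ' * A + ζ * B + 2 * (1 - t) * c = 0) :
    (e / t * A + ζ * (e * (1 + k) / t ^ 2) * c = 1 ∧
      e / t * B + ζ' * (e * (1 + k) / t ^ 2) * c = 0) ↔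
    (A = t / (2 * e * (1 + k * (2 - t))) * (t + k * (2 - t)) ∧
      B = t / (2 * e * (1 + k * (2 - t))) * (-(ζ' ^ 2 * (1 + k) / t)) ∧
      c = t / (2 * e * (1 + k * (2 - t))) * ζ') := by
  constructor
  · rintro ⟨h1, h2⟩
    field_simp at h1 h2
    have hc : c = t / (2 * e * (1 + k * (2 - t))) * ζ' := by
      field_simp
      -- eliminate `A` and `B` by means of `hC`
      have h3 : t * (c * 2 * e * (1 + k * (2 - t))) = t * (t * ζ') := by
        linear_combination ζ' * h1 + ζ * h2 - e * t * hC - 2 * e * c * (1 + k) * hζ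
      exact mul_left_cancel₀ ht h3
    have hB : B = t / (2 * e * (1 + k * (2 - t))) * (-(ζ' ^ 2 * (1 + k) / t)) := by
      rw [hc] at h2
      field_simp at h2 ⊢
      linear_combination h2
    have hA : A = t / (2 * e * (1 + k * (2 - t))) * (t + k * (2 - t)) := by
      rw [hc] at h1
      field_simp at h1 ⊢
      linear_combination h1 - (1 + k) * hζ
    exact ⟨hA, hB, hc⟩
  · rintro ⟨rfl, rfl, rfl⟩
    constructor
    · field_simp
      linear_combination (1 + k) * hζ
    · field_simp
      ring

/-- Light cone coordinates: the vector in `ℂ³` with given `a₀ + i a₁`, `a₀ - i a₁` and `a₂`. -/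
noncomputable def ofLightCone (A B c : ℂ) : Fin 3 → ℂ :=
  ![(A + B) / 2, -(Complex.I * (A - B)) / 2, c]

theorem eq_ofLightCone_iff {a : Fin 3 → ℂ} {A B c : ℂ} : a = ofLightCone A B c ↔
    a 0 + Complex.I * a 1 = A ∧ a 0 - Complex.I * a 1 = B ∧ a 2 = c := by
  constructor
  · rintro rfl
    simp only [ofLightCone, Matrix.cons_val_zero, Matrix.cons_val_one, Matrix.cons_val]
    refine ⟨?_, ?_, trivial⟩
    · linear_combination (-(A - B) / 2) * Complex.I_sq
    · linear_combination ((A - B) / 2) * Complex.I_sq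
  · rintro ⟨rfl, rfl, rfl⟩
    funext i
    fin_cases i <;> simp [ofLightCone]
    linear_combination (a 1) * Complex.I_sq

theorem exists_cincl_eq_ofLightCone (p : S2) {A B c : ℂ}
    (h : ((p.1 0 : ℂ) - Complex.I * (p.1 1 : ℂ)) * A +
      ((p.1 0 : ℂ) + Complex.I * (p.1 1 : ℂ)) * B + 2 * (p.1 2 : ℂ) * c = 0) :
    ∃ X, cincl p X = ofLightCone A B c := by
  refine exists_cincl_eq p _ ?_
  simp only [ofLightCone, Matrix.cons_val_zero, Matrix.cons_val_one, Matrix.cons_val]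
  linear_combination h / 2

theorem inner_cincl_lightCone (p : S2) (X : CTangent p) :
    ((p.1 0 : ℂ) - Complex.I * (p.1 1 : ℂ)) * (cincl p X 0 + Complex.I * cincl p X 1) +
      ((p.1 0 : ℂ) + Complex.I * (p.1 1 : ℂ)) * (cincl p X 0 - Complex.I * cincl p X 1) +
      2 * (p.1 2 : ℂ) * cincl p X 2 = 0 := by
  linear_combination 2 * inner_cincl p X
    - 2 * (p.1 1 : ℂ) * cincl p X 1 * Complex.I_sq

theorem height_continuous : Continuous fun q : S2 => q.1 2 :=
  (EuclideanSpace.proj (𝕜 := ℝ) (2 : Fin 3)).continuous.comp continuous_subtype_val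

/-- The differentials of `w_s` and of its conjugate away from the pole over `N`. At the pole over
`0` the last coefficient vanishes, so the second derivative of `ψ` plays no role there. -/
theorem cdiff_vertexCoord (hN : 0 < N) (hψ : IsOneBump N m α ψ) (p : S2) (hp : p.1 2 < 1)
    (s : ℝ) : ∃ e : ℝ, 0 < e ∧ ∃ c : Fin 3 → ℂ,
    c = ![((e / (1 - p.1 2) : ℝ) : ℂ), Complex.I * ((e / (1 - p.1 2) : ℝ) : ℂ),
      ((p.1 0 : ℂ) + Complex.I * (p.1 1 : ℂ)) *
        ((e * (1 + s * (iteratedDerivWithin 2 ψ (polytope N) (moment N p) *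
          (N / 2 * (1 - p.1 2)))) / (1 - p.1 2) ^ 2 : ℝ) : ℂ)] ∧
    (∀ X, cdiff (vertexCoord N ψ s p) p X =
      c 0 * cincl p X 0 + c 1 * cincl p X 1 + c 2 * cincl p X 2) ∧
    ∀ X, cdiff (fun q => star (vertexCoord N ψ s p q)) p X =
      star (c 0) * cincl p X 0 + star (c 1) * cincl p X 1 + star (c 2) * cincl p X 2 := by
  obtain ⟨Ψ, hΨc, hΨ, hΨ'⟩ := hψ.exists_extension hN
  let G : ℝ → ℝ := fun y => Real.exp (s * Ψ (N * (1 + y) / 2)) / (1 - y)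
  have hv : vertexCoord N ψ s p = holCoord N ψ s := if_pos ((moment_lt_iff hN p).2 hp)
  have hev : vertexCoord N ψ s p =ᶠ[𝓝 p] fun q =>
      (fun y : EuclideanSpace ℝ (Fin 3) => (G (y 2) : ℂ) * ((y 0 : ℂ) + Complex.I * (y 1 : ℂ)))
        q.1 := by
    rw [hv]
    filter_upwards [(isOpen_Iio.preimage height_continuous).mem_nhds hp] with q hq
    exact holCoord_eq hN hΨ s q hq
  have ht : 1 - p.1 2 ≠ 0 := by linarith
  refine ⟨Real.exp (s * Ψ (N * (1 + p.1 2) / 2)), Real.exp_pos _, _, rfl, ?_⟩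
  suffices H : ∃ F' : EuclideanSpace ℝ (Fin 3) →L[ℝ] ℂ, HasFDerivAt
      (fun y : EuclideanSpace ℝ (Fin 3) => (G (y 2) : ℂ) * ((y 0 : ℂ) + Complex.I * (y 1 : ℂ)))
      F' p.1 ∧ ∀ v, F' v = (G (p.1 2) : ℂ) * (v 0 : ℂ) + (Complex.I * (G (p.1 2) : ℂ)) * (v 1 : ℂ) +
        (((p.1 0 : ℂ) + Complex.I * (p.1 1 : ℂ)) *
          ((Real.exp (s * Ψ (N * (1 + p.1 2) / 2)) *
            (1 + s * (iteratedDerivWithin 2 ψ (polytope N) (moment N p) *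
              (N / 2 * (1 - p.1 2)))) / (1 - p.1 2) ^ 2 : ℝ) : ℂ)) * (v 2 : ℂ) by
    obtain ⟨F', hF, hF'⟩ := H
    exact ⟨cdiff_eq hev hF hF', cdiff_star_eq hev hF hF'⟩
  by_cases h : -1 < p.1 2
  · have hx := (moment_mem_Ioo_iff hN p).2 ⟨h, hp⟩
    have h1 : HasDerivAt (fun y : ℝ => N * (1 + y) / 2) ((N : ℝ) / 2) (p.1 2) := by
      refine ((((hasDerivAt_id (p.1 2)).const_add 1).const_mul (N : ℝ)).div_const 2).congr_deriv ?_
      ring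
    have h2 := ((HasDerivAt.comp (p.1 2) (h₂ := Ψ) (hΨ' _ hx) h1).const_mul s).exp
    have hG := h2.div ((hasDerivAt_id (p.1 2)).const_sub 1) ht
    refine hasFDerivAt_mul_horizontal Complex.I (G := G) (x := p.1) (hG.congr_deriv ?_)
    simp only [Function.comp_apply, id]
    change _ = Real.exp (s * Ψ (N * (1 + p.1 2) / 2)) *
      (1 + s * (iteratedDerivWithin 2 ψ (polytope N) (N * (1 + p.1 2) / 2) *
        (N / 2 * (1 - p.1 2)))) / (1 - p.1 2) ^ 2
    ring
  · have hz := (horizontal_eq_zero_iff p).2 fun h' => h h'.1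
    have hG : ContinuousAt G (p.1 2) := by
      refine ContinuousAt.div ?_ (by fun_prop) ht
      fun_prop
    refine ⟨_, hasFDerivAt_mul_horizontal_of_eq_zero Complex.I hG hz, fun v => ?_⟩
    simp only [smul_apply, horizontalForm_apply, smul_eq_mul, hz, zero_mul]
    ring

/-- The differentials of `1 / w_s` and of its conjugate at the pole over `N`. -/
theorem cdiff_vertexCoord_north (hN : 0 < N) (hψ : IsOneBump N m α ψ) (p : S2) (hp : p.1 2 = 1)
    (s : ℝ) : ∃ e : ℝ, 0 < e ∧
    (∀ X, cdiff (vertexCoord N ψ s p) p X =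
      (e : ℂ) * (cincl p X 0 - Complex.I * cincl p X 1)) ∧
    ∀ X, cdiff (fun q => star (vertexCoord N ψ s p q)) p X =
      (e : ℂ) * (cincl p X 0 + Complex.I * cincl p X 1) := by
  obtain ⟨Ψ, hΨc, hΨ, -⟩ := hψ.exists_extension hN
  let G : ℝ → ℝ := fun y => Real.exp (-(s * Ψ (N * (1 + y) / 2))) / (1 + y)
  have hv : vertexCoord N ψ s p = fun q => (holCoord N ψ s q)⁻¹ :=
    if_neg (by rw [moment_lt_iff hN, hp]; exact lt_irrefl _)
  have hp' : -1 < p.1 2 := by rw [hp]; norm_num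
  have ht : 1 + p.1 2 ≠ 0 := by rw [hp]; norm_num
  have hev : vertexCoord N ψ s p =ᶠ[𝓝 p] fun q =>
      (fun y : EuclideanSpace ℝ (Fin 3) => (G (y 2) : ℂ) * ((y 0 : ℂ) + -Complex.I * (y 1 : ℂ)))
        q.1 := by
    rw [hv]
    filter_upwards [(isOpen_Ioi.preimage height_continuous).mem_nhds hp'] with q hq
    rw [holCoord_inv_eq hN hΨ s q hq]
    ring
  have hz := (horizontal_eq_zero_iff p).2 fun h' => h'.2.ne hp
  have h0 := congrArg Complex.re hz
  have h1 := congrArg Complex.im hz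
  simp at h0 h1
  have hz' : (p.1 0 : ℂ) + -Complex.I * (p.1 1 : ℂ) = 0 := by simp [h0, h1]
  have hG : ContinuousAt G (p.1 2) := by
    refine ContinuousAt.div ?_ (by fun_prop) ht
    fun_prop
  have hF := hasFDerivAt_mul_horizontal_of_eq_zero (-Complex.I) hG hz'
  have hc : ∀ v, ((G (p.1 2) : ℂ) • horizontalForm (-Complex.I)) v =
      (![(G (p.1 2) : ℂ), -Complex.I * (G (p.1 2) : ℂ), 0] : Fin 3 → ℂ) 0 * (v 0 : ℂ) +
        (![(G (p.1 2) : ℂ), -Complex.I * (G (p.1 2) : ℂ), 0] : Fin 3 → ℂ) 1 * (v 1 : ℂ) +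
        (![(G (p.1 2) : ℂ), -Complex.I * (G (p.1 2) : ℂ), 0] : Fin 3 → ℂ) 2 * (v 2 : ℂ) := by
    intro v
    simp only [smul_apply, horizontalForm_apply, smul_eq_mul,
        Matrix.cons_val_zero, Matrix.cons_val_one, Matrix.cons_val]
    ring
  refine ⟨G (p.1 2), ?_, fun X => ?_, fun X => ?_⟩
  · exact div_pos (Real.exp_pos _) (by rw [hp]; norm_num)
  · rw [cdiff_eq hev hF hc]
    simp only [Matrix.cons_val_zero, Matrix.cons_val_one, Matrix.cons_val]
    ring
  · rw [cdiff_star_eq hev hF hc]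
    simp
    ring

/-- Over each point, `∂/∂w_s` is a multiple of `u₀ + s r u₁` with fixed `u₀`, `u₁` and with
`r = (N / 2) (1 - p₂) ψ''`. At the poles `u₁ = 0`; elsewhere `u₁` is a nonzero multiple of `∂/∂θ`,
and `u₀` is transverse to it since its vertical component is not zero. -/
theorem exists_coordVectors_eq (hN : 0 < N) (hψ : IsOneBump N m α ψ) (p : S2) :
    ∃ (u₀ u₁ : CTangent p),
      (∀ s : ℝ, 0 ≤ s → ∃ c : ℂ, c ≠ 0 ∧ coordVectors (vertexCoord N ψ s p) p =
        {c • (u₀ + ((s * (iteratedDerivWithin 2 ψ (polytope N) (moment N p) *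
          (N / 2 * (1 - p.1 2))) : ℝ) : ℂ) • u₁)}) ∧
      (¬(-1 < p.1 2 ∧ p.1 2 < 1) → u₁ = 0) ∧
      ((-1 < p.1 2 ∧ p.1 2 < 1) → cincl p u₀ 2 ≠ 0 ∧ ∃ d : ℂ, d ≠ 0 ∧
        cincl p u₁ = d • ![-(p.1 1 : ℂ), (p.1 0 : ℂ), 0]) := by
  rcases lt_or_eq_of_le (abs_height_le p).2 with hp | hp
  · have htR : 0 < 1 - p.1 2 := by linarith
    set t : ℂ := 1 - (p.1 2 : ℂ) with ht_def
    have htC : ((1 - p.1 2 : ℝ) : ℂ) = t := by push_cast; rfl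
    have ht : t ≠ 0 := by rw [← htC]; exact Complex.ofReal_ne_zero.2 htR.ne'
    have hp2 : (p.1 2 : ℂ) = 1 - t := by rw [ht_def]; ring
    set ζ : ℂ := (p.1 0 : ℂ) + Complex.I * (p.1 1 : ℂ) with hζ_def
    set ζ' : ℂ := (p.1 0 : ℂ) - Complex.I * (p.1 1 : ℂ) with hζ'_def
    have hζ : ζ * ζ' = t * (2 - t) := by
      have hs := congrArg Complex.ofReal (sum_sq p)
      push_cast at hs
      rw [hζ_def, hζ'_def, ht_def]
      linear_combination hs - (p.1 1 : ℂ) ^ 2 * Complex.I_sq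
    have hstar : star ζ = ζ' := by
      rw [hζ_def, hζ'_def]
      simp [sub_eq_add_neg]
    obtain ⟨u₀, hu₀⟩ := exists_cincl_eq_ofLightCone p (A := t) (B := -(ζ' ^ 2 / t)) (c := ζ') (by
      rw [← hζ_def, ← hζ'_def, hp2]
      field_simp
      linear_combination (-ζ') * hζ)
    obtain ⟨u₁, hu₁⟩ := exists_cincl_eq_ofLightCone p (A := 2 - t) (B := -(ζ' ^ 2 / t)) (c := 0) (by
      rw [← hζ_def, ← hζ'_def, hp2]
      field_simp
      linear_combination (-ζ') * hζ)
    have hu₁' : cincl p u₁ = (-(Complex.I * ζ') / t) • ![-(p.1 1 : ℂ), (p.1 0 : ℂ), 0] := by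
      rw [hu₁, eq_comm, eq_ofLightCone_iff]
      simp only [Pi.smul_apply, smul_eq_mul, Matrix.cons_val_zero, Matrix.cons_val_one,
        Matrix.cons_val]
      refine ⟨?_, ?_, by ring⟩
      · field_simp
        linear_combination hζ - ζ' * p.1 0 * Complex.I_sq + ζ' * (-hζ_def)
      · field_simp
        linear_combination ζ' * p.1 0 * Complex.I_sq + ζ' * hζ'_def
    refine ⟨u₀, u₁, fun s hs => ?_, fun h => ?_, fun h => ⟨?_, _, ?_, hu₁'⟩⟩
    · obtain ⟨e, he, c, hc, hw, hw'⟩ := cdiff_vertexCoord hN hψ p hp s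
      set k : ℝ := s * (iteratedDerivWithin 2 ψ (polytope N) (moment N p) *
          (N / 2 * (1 - p.1 2))) with hk
      have hk0 : 0 ≤ k := mul_nonneg hs (mul_nonneg (hψ.second_nonneg (moment_mem_polytope N p))
        (mul_nonneg (by positivity) htR.le))
      have heC : (e : ℂ) ≠ 0 := Complex.ofReal_ne_zero.2 he.ne'
      -- the determinant of the system is positive because `ψ''` is nonnegative
      have hD : 1 + (k : ℂ) * (2 - t) ≠ 0 := by
        have h1 : (0 : ℝ) < 1 + k * (2 - (1 - p.1 2)) := by
          have := mul_nonneg hk0 (show 0 ≤ 2 - (1 - p.1 2) by linarith [(abs_height_le p).1])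
          linarith
        have := Complex.ofReal_ne_zero.2 h1.ne'
        push_cast at this
        exact this
      refine ⟨t / (2 * e * (1 + k * (2 - t))), div_ne_zero ht
        (mul_ne_zero (mul_ne_zero two_ne_zero heC) hD), ?_⟩
      ext X
      rw [mem_singleton_iff, ← (cincl_injective p).eq_iff]
      have hvec : cincl p ((t / (2 * e * (1 + k * (2 - t)))) • (u₀ + (k : ℂ) • u₁)) =
          ofLightCone (t / (2 * e * (1 + k * (2 - t))) * (t + k * (2 - t)))
            (t / (2 * e * (1 + k * (2 - t))) * (-(ζ' ^ 2 * (1 + k) / t)))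
            (t / (2 * e * (1 + k * (2 - t))) * ζ') := by
        rw [map_smul, map_add, map_smul, hu₀, hu₁]
        funext i
        fin_cases i <;> simp [ofLightCone] <;> ring
      have hC := inner_cincl_lightCone p X
      rw [← hζ_def, ← hζ'_def, hp2] at hC
      rw [hvec, eq_ofLightCone_iff, ← coordinate_system_iff ht heC hD hζ hC, coordVectors,
        mem_ofPred_eq, hw, hw', hc]
      simp only [Matrix.cons_val_zero, Matrix.cons_val_one, Matrix.cons_val, star_mul',
        Complex.star_def, Complex.conj_ofReal, Complex.conj_I]
      push_cast
      rw [← ht_def]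
      rw [← hζ_def]
      refine and_congr (Eq.congr_left ?_) (Eq.congr_left ?_)
      · ring
      · rw [← Complex.star_def, hstar]
        ring
    · have hζ0 := (horizontal_eq_zero_iff p).2 h
      refine cincl_injective p ?_
      have hz : ζ' = 0 := by rw [← hstar, hζ_def, hζ0, star_zero]
      rw [hu₁', map_zero, hz]
      simp
    · rw [hu₀]
      change ζ' ≠ 0
      rw [← hstar, star_ne_zero]
      exact fun h0 => (horizontal_eq_zero_iff p).1 h0 h
    · have : ζ' ≠ 0 := by
        rw [← hstar, star_ne_zero]
        exact fun h0 => (horizontal_eq_zero_iff p).1 h0 h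
      exact div_ne_zero (neg_ne_zero.2 (mul_ne_zero Complex.I_ne_zero this)) ht
  · have hnot : ¬(-1 < p.1 2 ∧ p.1 2 < 1) := fun h => h.2.ne hp
    have hζ := (horizontal_eq_zero_iff p).2 hnot
    have h0 := congrArg Complex.re hζ
    have h1 := congrArg Complex.im hζ
    simp at h0 h1
    obtain ⟨u, hu⟩ := exists_cincl_eq_ofLightCone p (A := 0) (B := 1) (c := 0) (by simp [h0, h1])
    refine ⟨u, 0, fun s _ => ?_, fun _ => rfl, fun h => (hnot h).elim⟩
    obtain ⟨e, he, hw, hw'⟩ := cdiff_vertexCoord_north hN hψ p hp s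
    have heC : (e : ℂ) ≠ 0 := Complex.ofReal_ne_zero.2 he.ne'
    refine ⟨(e : ℂ)⁻¹, inv_ne_zero heC, ?_⟩
    ext X
    rw [mem_singleton_iff, ← (cincl_injective p).eq_iff, smul_zero, add_zero]
    have hvec : cincl p ((e : ℂ)⁻¹ • u) = ofLightCone 0 (e : ℂ)⁻¹ 0 := by
      rw [map_smul, hu]
      funext i
      fin_cases i <;> simp [ofLightCone] <;> ring
    have hC := inner_cincl_lightCone p X
    rw [h0, h1, hp] at hC
    have hC' : cincl p X 2 = 0 := by simpa using hC
    rw [hvec, eq_ofLightCone_iff, coordVectors, mem_ofPred_eq, hw, hw']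
    constructor
    · rintro ⟨ha, hb⟩
      exact ⟨(mul_eq_zero.1 hb).resolve_left heC, eq_inv_of_mul_eq_one_right ha, hC'⟩
    · rintro ⟨ha, hb, -⟩
      rw [ha, hb]
      exact ⟨mul_inv_cancel₀ heC, mul_zero _⟩

end CoordinateVectors

section Polarizations

variable {N : ℕ} {m α : ℝ} {ψ : ℝ → ℝ}

/-! ### The polarizations as complex lines -/

theorem exists_realPolarization_eq (p : S2) : ∃ u : CTangent p,
    cincl p u = ![-(p.1 1 : ℂ), (p.1 0 : ℂ), 0] ∧
      realPolarization p = Submodule.span ℂ {u} := by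
  obtain ⟨v, hv⟩ := (exists_dincl_eq_iff p ![-p.1 1, p.1 0, 0]).2 (by simp; ring)
  have hr : rotationVectors p = {v} := by
    ext w
    rw [mem_singleton_iff, ← (dincl_injective p).eq_iff, hv]
    rfl
  refine ⟨(1 : ℂ) ⊗ₜ[ℝ] v, ?_, ?_⟩
  · funext i
    rw [cincl_tmul, hv]
    fin_cases i <;> simp
  · rw [realPolarization, hr, Submodule.baseChange_span, image_singleton]
    rfl

theorem realPolarization_eq_bot {p : S2} (hp : ¬(-1 < p.1 2 ∧ p.1 2 < 1)) :
    realPolarization p = ⊥ := by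
  obtain ⟨u, hu, hr⟩ := exists_realPolarization_eq p
  have hζ := (horizontal_eq_zero_iff p).2 hp
  have h0 := congrArg Complex.re hζ
  have h1 := congrArg Complex.im hζ
  simp at h0 h1
  rw [hr, Submodule.span_singleton_eq_bot]
  refine cincl_injective p ?_
  rw [hu, map_zero, h0, h1]
  simp

theorem mem_realPolarization_iff {p : S2} (hp : -1 < p.1 2 ∧ p.1 2 < 1) (X : CTangent p) :
    X ∈ realPolarization p ↔ cincl p X 2 = 0 := by
  obtain ⟨u, hu, hr⟩ := exists_realPolarization_eq p
  rw [hr, Submodule.mem_span_singleton]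
  constructor
  · rintro ⟨c, rfl⟩
    rw [map_smul, hu]
    simp
  · intro h
    have hρ : (p.1 0 : ℂ) ^ 2 + (p.1 1 : ℂ) ^ 2 ≠ 0 := by
      have h1 : p.1 0 ^ 2 + p.1 1 ^ 2 ≠ 0 := by
        have := sum_sq p
        nlinarith
      have := Complex.ofReal_ne_zero.2 h1
      push_cast at this
      exact this
    have hC := inner_cincl p X
    rw [h] at hC
    refine ⟨((p.1 0 : ℂ) * cincl p X 1 - (p.1 1 : ℂ) * cincl p X 0) /
      ((p.1 0 : ℂ) ^ 2 + (p.1 1 : ℂ) ^ 2), cincl_injective p ?_⟩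
    rw [map_smul, hu]
    funext i
    fin_cases i
    · simp only [Pi.smul_apply, smul_eq_mul, Fin.zero_eta, Matrix.cons_val_zero]
      field_simp
      linear_combination (-(p.1 0 : ℂ)) * hC
    · simp only [Pi.smul_apply, smul_eq_mul, Fin.mk_one, Matrix.cons_val_one,
        Matrix.cons_val_zero]
      field_simp
      linear_combination (-(p.1 1 : ℂ)) * hC
    · simp [h]

theorem span_coordVectors_eq {w : S2 → ℂ} {p : S2} {u : CTangent p} {c : ℂ} (hc : c ≠ 0)
    (h : coordVectors w p = {c • u}) :
    Submodule.span ℂ (coordVectors w p) = Submodule.span ℂ {u} ∧ u ≠ 0 := by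
  refine ⟨by rw [h, Submodule.span_singleton_smul_eq (IsUnit.mk0 c hc)], ?_⟩
  rintro rfl
  have h1 : (0 : CTangent p) ∈ coordVectors w p := by rw [h, smul_zero]; rfl
  have h2 := h1.1
  rw [map_zero] at h2
  exact zero_ne_one h2

theorem exists_kahlerPolarization_eq (hN : 0 < N) (hψ : IsOneBump N m α ψ) (p : S2) :
    ∃ (u₀ u₁ : CTangent p),
      (∀ s : ℝ, 0 ≤ s → kahlerPolarization N ψ s p =
        Submodule.span ℂ {u₀ + ((s * (iteratedDerivWithin 2 ψ (polytope N) (moment N p) *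
          (N / 2 * (1 - p.1 2))) : ℝ) : ℂ) • u₁} ∧
        u₀ + ((s * (iteratedDerivWithin 2 ψ (polytope N) (moment N p) *
          (N / 2 * (1 - p.1 2))) : ℝ) : ℂ) • u₁ ≠ 0) ∧
      (¬(-1 < p.1 2 ∧ p.1 2 < 1) → u₁ = 0) ∧
      ((-1 < p.1 2 ∧ p.1 2 < 1) → cincl p u₀ 2 ≠ 0 ∧ u₁ ≠ 0 ∧
        realPolarization p = Submodule.span ℂ {u₁}) := by
  obtain ⟨u₀, u₁, h1, h2, h3⟩ := exists_coordVectors_eq hN hψ p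
  refine ⟨u₀, u₁, fun s hs => ?_, h2, fun hp => ?_⟩
  · obtain ⟨c, hc, h⟩ := h1 s hs
    exact span_coordVectors_eq hc h
  · obtain ⟨h4, d, hd, hu₁⟩ := h3 hp
    obtain ⟨u, hu, hr⟩ := exists_realPolarization_eq p
    have he : u₁ = d • u := cincl_injective p (by rw [hu₁, map_smul, hu])
    refine ⟨h4, ?_, by rw [hr, he, Submodule.span_singleton_smul_eq (IsUnit.mk0 d hd)]⟩
    rintro rfl
    rw [map_zero, eq_comm, smul_eq_zero, or_iff_right hd] at hu₁
    have e0 := congrFun hu₁ 0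
    have e1 := congrFun hu₁ 1
    simp at e0 e1
    refine (horizontal_eq_zero_iff p).1 ?_ hp
    rw [e0, e1]
    simp

/-! ### The support of the bump -/

theorem mem_interior_bumpSet_iff {x : ℝ} :
    x ∈ interior (bumpSet N m α) ↔ x ∈ Ioo 0 (N : ℝ) ∧ |x - m| < α := by
  rw [bumpSet, polytope, interior_inter, interior_Icc, interior_Icc, mem_inter_iff, and_comm,
    abs_lt, mem_Ioo]
  refine and_congr_right fun _ => ?_
  constructor <;> rintro ⟨h1, h2⟩ <;> constructor <;> linarith

theorem bumpSet_subset_closure_interior (hN : 0 < N) (hm : m ∈ polytope N) (hα : 0 < α) :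
    bumpSet N m α ⊆ closure (interior (bumpSet N m α)) := by
  have hN' : (0 : ℝ) < N := by exact_mod_cast hN
  rw [bumpSet, polytope, Icc_inter_Icc, closure_interior_Icc]
  refine ne_of_lt (max_lt (lt_min ?_ ?_) (lt_min ?_ hN')) <;> linarith [hm.1, hm.2]

theorem second_eq_zero_of_notMem_interior (hψ : IsOneBump N m α ψ) {x : ℝ}
    (hx : x ∈ Ioo 0 (N : ℝ)) (h : x ∉ interior (bumpSet N m α)) :
    iteratedDerivWithin 2 ψ (polytope N) x = 0 := by
  refine hψ.zero x (Ioo_subset_Icc_self hx) (not_lt.1 fun h' => h ?_)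
  exact mem_interior_bumpSet_iff.2 ⟨hx, h'⟩

theorem second_pos_of_mem_interior (hψ : IsOneBump N m α ψ) {x : ℝ}
    (h : x ∈ interior (bumpSet N m α)) : 0 < iteratedDerivWithin 2 ψ (polytope N) x :=
  hψ.pos x (Ioo_subset_Icc_self (mem_interior_bumpSet_iff.1 h).1) (mem_interior_bumpSet_iff.1 h).2

theorem height_mem_of_mem_interior (hN : 0 < N) {p : S2}
    (h : moment N p ∈ interior (bumpSet N m α)) : -1 < p.1 2 ∧ p.1 2 < 1 :=
  (moment_mem_Ioo_iff hN p).1 (mem_interior_bumpSet_iff.1 h).1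

/-! ### Lagrangian condition and limit -/

theorem isLagrangian_kahlerPolarization (hN : 0 < N) (hψ : IsOneBump N m α ψ) (s : ℝ≥0) (p : S2) :
    IsLagrangian ((symplecticForm N p).baseChange ℂ) (kahlerPolarization N ψ s p) := by
  obtain ⟨u₀, u₁, h1, -⟩ := exists_kahlerPolarization_eq hN hψ p
  rw [(h1 s s.2).1]
  exact isLagrangian_span_singleton N hN p _ (h1 s s.2).2

theorem isLagrangian_realPolarization (hN : 0 < N) (hψ : IsOneBump N m α ψ) {p : S2}
    (hp : -1 < p.1 2 ∧ p.1 2 < 1) :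
    IsLagrangian ((symplecticForm N p).baseChange ℂ) (realPolarization p) := by
  obtain ⟨u₀, u₁, -, -, h3⟩ := exists_kahlerPolarization_eq hN hψ p
  rw [(h3 hp).2.2]
  exact isLagrangian_span_singleton N hN p _ (h3 hp).2.1

instance t2Space_lagGr (N : ℕ) [NeZero N] (p : S2) : T2Space (LagGr N p) :=
  LagrangianGrassmannian.t2Space (isLagrangian_span_singleton N (NeZero.pos N) p) (cincl p)
    (cincl_injective p)

theorem kahlerPolarization_eq_zero (hN : 0 < N) (hψ : IsOneBump N m α ψ) {p : S2}
    (h : moment N p ∉ interior (bumpSet N m α)) (s : ℝ≥0) :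
    kahlerPolarization N ψ s p = kahlerPolarization N ψ 0 p := by
  obtain ⟨u₀, u₁, h1, h2, -⟩ := exists_kahlerPolarization_eq hN hψ p
  rw [(h1 s s.2).1, (h1 0 le_rfl).1]
  by_cases hp : -1 < p.1 2 ∧ p.1 2 < 1
  · rw [second_eq_zero_of_notMem_interior hψ ((moment_mem_Ioo_iff hN p).2 hp) h]
    simp
  · rw [h2 hp, smul_zero, smul_zero]

/-- Off the poles, the polarization at `s = 0` is transverse to the real polarization. -/
theorem eq_zero_of_mem_kahlerPolarization (hN : 0 < N) (hψ : IsOneBump N m α ψ) {p : S2}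
    (hp : -1 < p.1 2 ∧ p.1 2 < 1) {X : CTangent p} (hX : X ∈ kahlerPolarization N ψ 0 p)
    (h0 : cincl p X 2 = 0) : X = 0 := by
  obtain ⟨u₀, u₁, h1, -, h3⟩ := exists_kahlerPolarization_eq hN hψ p
  rw [(h1 0 le_rfl).1, Submodule.mem_span_singleton] at hX
  obtain ⟨c, rfl⟩ := hX
  simp only [zero_mul, Complex.ofReal_zero, zero_smul, add_zero, map_smul, Pi.smul_apply,
    smul_eq_mul, mul_eq_zero] at h0 ⊢
  rw [h0.resolve_right (h3 hp).1, zero_smul]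

theorem tendsto_kahlerPolarization (hN : 0 < N) (hψ : IsOneBump N m α ψ) {p : S2}
    (h : moment N p ∈ interior (bumpSet N m α)) (P : ℝ≥0 → LagGr N p)
    (hP : ∀ s, (P s).space = kahlerPolarization N ψ s p) (Q : LagGr N p)
    (hQ : Q.space = realPolarization p) : Tendsto P atTop (𝓝 Q) := by
  have hp := height_mem_of_mem_interior hN h
  obtain ⟨u₀, u₁, h1, -, h3⟩ := exists_kahlerPolarization_eq hN hψ p
  obtain ⟨-, h4, h5⟩ := h3 hp
  have hN' : (0 : ℝ) < N := by exact_mod_cast hN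
  have hr : 0 < iteratedDerivWithin 2 ψ (polytope N) (moment N p) * (N / 2 * (1 - p.1 2)) :=
    mul_pos (second_pos_of_mem_interior hψ h) (mul_pos (by positivity) (by linarith [hp.2]))
  refine tendsto_line (isLagrangian_span_singleton N hN p) (u₀ := u₀) (u₁ := u₁)
    (k := fun s : ℝ≥0 => (s : ℝ) * (iteratedDerivWithin 2 ψ (polytope N) (moment N p) *
      (N / 2 * (1 - p.1 2)))) ?_ (fun s => (h1 s s.2).2) h4 P
    (fun s => by rw [hP]; exact (h1 s s.2).1) Q (by rw [hQ, h5])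
  exact (NNReal.tendsto_coe_atTop.2 tendsto_id).atTop_mul_const hr

/-- At the poles the vertex coordinate vanishes, so no coordinate vector is left out. -/
theorem vanishingCoordSpan_eq {p : S2} (hp : ¬(-1 < p.1 2 ∧ p.1 2 < 1))
    (s : ℝ) : vanishingCoordSpan N ψ s p = kahlerPolarization N ψ s p := by
  have hw : holCoord N ψ s p = 0 := by
    rw [holCoord, phase, (horizontal_eq_zero_iff p).2 hp]
    simp
  have hv : vertexCoord N ψ s p p = 0 := by
    unfold vertexCoord
    split_ifs
    · exact hw
    · change (holCoord N ψ s p)⁻¹ = 0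
      rw [hw, inv_zero]
  simp only [vanishingCoordSpan, kahlerPolarization, hv, true_and]
  rfl

/-! ### Meridians -/

/-- The meridian through the equatorial point `(a, b, 0)`, parametrized by the values `x ∈ [0, N]`
of the moment map and constant outside `[0, N]`. -/
noncomputable def meridian (N : ℕ) (a b : ℝ) (hab : a ^ 2 + b ^ 2 = 1) (x : ℝ) : S2 :=
  ⟨!₂[a * Real.cos (Real.arcsin (2 * x / N - 1)), b * Real.cos (Real.arcsin (2 * x / N - 1)),
    Real.sin (Real.arcsin (2 * x / N - 1))], by
    rw [mem_sphere_zero_iff_norm, ← sq_eq_sq₀ (norm_nonneg _) zero_le_one,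
      EuclideanSpace.norm_sq_eq, Fin.sum_univ_three]
    simp only [Real.norm_eq_abs, sq_abs, Matrix.cons_val_zero, Matrix.cons_val_one,
      Matrix.cons_val]
    linear_combination (Real.cos (Real.arcsin (2 * x / N - 1))) ^ 2 * hab +
      Real.sin_sq_add_cos_sq (Real.arcsin (2 * x / N - 1))⟩

variable {a b : ℝ} {hab : a ^ 2 + b ^ 2 = 1}

theorem continuous_meridian : Continuous (meridian N a b hab) := by
  refine Continuous.subtype_mk ?_ _
  refine (PiLp.continuous_toLp 2 _).comp (continuous_pi fun i => ?_)
  have h : Continuous fun x : ℝ => Real.arcsin (2 * x / N - 1) :=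
    Real.continuous_arcsin.comp (by fun_prop)
  fin_cases i
  · exact continuous_const.mul (Real.continuous_cos.comp h)
  · exact continuous_const.mul (Real.continuous_cos.comp h)
  · exact Real.continuous_sin.comp h

theorem moment_meridian (hN : 0 < N) {x : ℝ} (hx : x ∈ polytope N) :
    moment N (meridian N a b hab x) = x := by
  have hN' : (0 : ℝ) < N := by exact_mod_cast hN
  have h : (meridian N a b hab x).1 2 = 2 * x / N - 1 := by
    refine Real.sin_arcsin ?_ ?_
    · have := div_nonneg (mul_nonneg zero_le_two hx.1) hN'.le
      linarith
    · have : 2 * x / N ≤ 2 := (div_le_iff₀ hN').2 (by linarith [hx.2])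
      linarith
  rw [moment, h]
  field_simp
  ring

theorem meridian_moment_eq (hN : 0 < N) (p : S2)
    (h0 : a * Real.cos (Real.arcsin (p.1 2)) = p.1 0)
    (h1 : b * Real.cos (Real.arcsin (p.1 2)) = p.1 1) :
    meridian N a b hab (moment N p) = p := by
  have hN' : (N : ℝ) ≠ 0 := by exact_mod_cast hN.ne'
  have h : 2 * moment N p / N - 1 = p.1 2 := by
    rw [moment]
    field_simp
    ring
  refine Subtype.ext (PiLp.ext fun i => ?_)
  have hb := abs_height_le p
  fin_cases i
  · change a * Real.cos (Real.arcsin (2 * moment N p / N - 1)) = _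
    rw [h]; exact h0
  · change b * Real.cos (Real.arcsin (2 * moment N p / N - 1)) = _
    rw [h]; exact h1
  · change Real.sin (Real.arcsin (2 * moment N p / N - 1)) = _
    rw [h]; exact Real.sin_arcsin hb.1 hb.2

theorem cos_arcsin_height_sq (p : S2) :
    Real.cos (Real.arcsin (p.1 2)) ^ 2 = p.1 0 ^ 2 + p.1 1 ^ 2 := by
  have hb := abs_height_le p
  have := sum_sq p
  rw [Real.cos_sq', Real.sin_arcsin hb.1 hb.2]
  linarith

/-- Each point off the poles lies on a meridian, with `(a, b)` its horizontal part normalized. -/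
theorem exists_meridian (hN : 0 < N) {p : S2} (hp : -1 < p.1 2 ∧ p.1 2 < 1) :
    ∃ (a b : ℝ) (hab : a ^ 2 + b ^ 2 = 1), meridian N a b hab (moment N p) = p := by
  have hc := cos_arcsin_height_sq p
  have hc0 : Real.cos (Real.arcsin (p.1 2)) ≠ 0 := by
    intro h
    have := sum_sq p
    rw [h] at hc
    nlinarith
  refine ⟨p.1 0 / Real.cos (Real.arcsin (p.1 2)), p.1 1 / Real.cos (Real.arcsin (p.1 2)), ?_,
    meridian_moment_eq hN p (div_mul_cancel₀ _ hc0) (div_mul_cancel₀ _ hc0)⟩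
  rw [div_pow, div_pow, ← add_div, ← hc, div_self (pow_ne_zero 2 hc0)]

/-- All meridians pass through the poles. -/
theorem meridian_moment_eq_of_pole (hN : 0 < N) {p : S2} (hp : ¬(-1 < p.1 2 ∧ p.1 2 < 1)) :
    meridian N a b hab (moment N p) = p := by
  have hζ := (horizontal_eq_zero_iff p).2 hp
  have h0 := congrArg Complex.re hζ
  have h1 := congrArg Complex.im hζ
  simp at h0 h1
  have hc : Real.cos (Real.arcsin (p.1 2)) = 0 := by
    have := cos_arcsin_height_sq p
    rw [h0, h1] at this
    simpa using this
  refine meridian_moment_eq hN p ?_ ?_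
  · rw [hc, h0, mul_zero]
  · rw [hc, h1, mul_zero]

/-- Away from the poles the moment map is open. -/
theorem moment_mem_interior (hN : 0 < N) {p : S2} (hp : -1 < p.1 2 ∧ p.1 2 < 1)
    (h : moment N ⁻¹' bumpSet N m α ∈ 𝓝 p) : moment N p ∈ interior (bumpSet N m α) := by
  obtain ⟨a, b, hab, hγ⟩ := exists_meridian hN hp
  rw [mem_interior_iff_mem_nhds]
  have h1 : ∀ᶠ x in 𝓝 (moment N p), moment N (meridian N a b hab x) ∈ bumpSet N m α :=
    (continuous_meridian.continuousAt (x := moment N p)).eventually (by rw [hγ]; exact h)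
  filter_upwards [h1, polytope_mem_nhds ((moment_mem_Ioo_iff hN p).2 hp)] with x hx hxP
  rwa [moment_meridian hN hxP] at hx

theorem continuous_moment : Continuous (moment N) := by
  have := height_continuous
  unfold moment
  fun_prop

/-- A pole over `S` is an interior point of `μ⁻¹(S)`: as `α > 0`, the set `S` is a neighbourhood in
`[0, N]` of each vertex that it contains. -/
theorem preimage_bumpSet_mem_nhds_of_pole (hN : 0 < N) (hm : m ∈ polytope N) (hα : 0 < α) {p : S2}
    (hp : ¬(-1 < p.1 2 ∧ p.1 2 < 1)) (h : moment N p ∈ bumpSet N m α) :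
    moment N ⁻¹' bumpSet N m α ∈ 𝓝 p := by
  have hP := moment_mem_polytope N p
  rw [← moment_mem_Ioo_iff hN, mem_Ioo, not_and_or, not_lt, not_lt] at hp
  rcases hp with hp | hp
  · have hlt : moment N p < m + α := by linarith [hm.1]
    filter_upwards [(isOpen_Iio.preimage continuous_moment).mem_nhds hlt] with q hq
    have hq' : moment N q < m + α := hq
    have hqP := moment_mem_polytope N q
    exact ⟨⟨by linarith [h.1.1, hqP.1], hq'.le⟩, hqP⟩
  · have hlt : m - α < moment N p := by linarith [hm.2]
    filter_upwards [(isOpen_Ioi.preimage continuous_moment).mem_nhds hlt] with q hq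
    have hq' : m - α < moment N q := hq
    have hqP := moment_mem_polytope N q
    exact ⟨⟨hq'.le, by linarith [h.1.2, hqP.2]⟩, hqP⟩

/-! ### Smooth sections -/

theorem continuousOn_dincl {K : Set S2} {A : ∀ p : S2, TangentSpace (𝓡 2) p}
    (hA : ContMDiffOn (𝓡 2) (𝓡 2).tangent ∞ (fun p => (⟨p, A p⟩ : TangentBundle (𝓡 2) S2)) K)
    (i : Fin 3) : ContinuousOn (fun p => dincl p (A p) i) K := by
  have h1 : Continuous (tangentMap (𝓡 2) 𝓘(ℝ, EuclideanSpace ℝ (Fin 3))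
      (fun q : S2 => (q : EuclideanSpace ℝ (Fin 3)))) :=
    (contMDiff_coe_sphere (m := 1)).continuous_tangentMap le_rfl
  have h2 : Continuous fun v : TangentBundle 𝓘(ℝ, EuclideanSpace ℝ (Fin 3))
      (EuclideanSpace ℝ (Fin 3)) => (v.2 : EuclideanSpace ℝ (Fin 3)) :=
    (contMDiff_snd_tangentBundle_modelSpace (n := 0) (EuclideanSpace ℝ (Fin 3))
      𝓘(ℝ, EuclideanSpace ℝ (Fin 3))).continuous
  exact ((EuclideanSpace.proj (𝕜 := ℝ) i).continuous.comp (h2.comp h1)).comp_continuousOn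
    hA.continuousOn

theorem continuous_cincl_of_mem_smoothSections {K : Set S2} {P : Distribution}
    {X : ∀ p : K, CTangent (p : S2)} (hX : X ∈ smoothSections K P) (i : Fin 3) :
    Continuous fun p : K => cincl p (X p) i := by
  obtain ⟨A, B, hA, hB, h⟩ := hX
  have hc : (fun p : K => cincl p (X p) i) =
      fun p : K => (dincl p (A p) i : ℂ) + (dincl p (B p) i : ℂ) * Complex.I := by
    funext p
    rw [(h p).1, cincl_re_im]
    exact Complex.mk_eq_add_mul_I _ _
  rw [hc]
  have h1 := continuousOn_iff_continuous_domRestrict.1 (continuousOn_dincl hA i)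
  have h2 := continuousOn_iff_continuous_domRestrict.1 (continuousOn_dincl hB i)
  exact (Complex.continuous_ofReal.comp h1).add
    ((Complex.continuous_ofReal.comp h2).mul continuous_const)

/-- A section lying in the real polarization over the interior of `S` has, at points reached along
the meridian of `(a, b, 0)`, no component along that meridian. -/
theorem cincl_eq_zero_of_meridian (hN : 0 < N) (hm : m ∈ polytope N) (hα : 0 < α) {K : Set S2}
    {P : Distribution} {X : ∀ p : K, CTangent (p : S2)} (hX : X ∈ smoothSections K P)
    (hP : ∀ p : S2, moment N p ∈ interior (bumpSet N m α) → P p = realPolarization p)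
    (p : K) (hγ : meridian N a b hab (moment N p) = p) (hp : moment N p ∈ bumpSet N m α)
    (hK : ∀ᶠ x in 𝓝 (moment N p), x ∈ interior (bumpSet N m α) → meridian N a b hab x ∈ K) :
    (a : ℂ) * cincl p (X p) 0 + (b : ℂ) * cincl p (X p) 1 = 0 ∧ cincl p (X p) 2 = 0 := by
  let T : Set K := {q | ∃ x ∈ interior (bumpSet N m α), meridian N a b hab x = q}
  let Z : Set K := {q | (a : ℂ) * cincl q (X q) 0 + (b : ℂ) * cincl q (X q) 1 = 0 ∧
    cincl q (X q) 2 = 0}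
  have hZ : IsClosed Z := by
    have c := continuous_cincl_of_mem_smoothSections hX
    exact (isClosed_eq ((continuous_const.mul (c 0)).add (continuous_const.mul (c 1)))
      continuous_const).inter (isClosed_eq (c 2) continuous_const)
  have hTZ : T ⊆ Z := by
    rintro q ⟨x, hx, hq⟩
    have hxI := (mem_interior_bumpSet_iff.1 hx).1
    have hμ : moment N q = x := by rw [← hq, moment_meridian hN (Ioo_subset_Icc_self hxI)]
    obtain ⟨A, B, -, -, h⟩ := hX
    have hq2 := (h q).2
    rw [hP q (by rw [hμ]; exact hx)] at hq2
    obtain ⟨u, hu, hr⟩ := exists_realPolarization_eq q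
    rw [hr, Submodule.mem_span_singleton] at hq2
    obtain ⟨c, hc⟩ := hq2
    have e0 : (q : S2).1 0 = a * Real.cos (Real.arcsin (2 * x / N - 1)) := by rw [← hq]; rfl
    have e1 : (q : S2).1 1 = b * Real.cos (Real.arcsin (2 * x / N - 1)) := by rw [← hq]; rfl
    change _ ∧ _
    rw [← hc, map_smul, hu, e0, e1]
    simp only [Pi.smul_apply, smul_eq_mul, Matrix.cons_val_zero, Matrix.cons_val_one,
      Matrix.cons_val]
    push_cast
    exact ⟨by ring, by ring⟩
  have hpT : p ∈ closure T := by
    rw [closure_subtype, mem_closure_iff_frequently]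
    have h1 : ∃ᶠ x in 𝓝 (moment N p), x ∈ interior (bumpSet N m α) :=
      mem_closure_iff_frequently.1 (bumpSet_subset_closure_interior hN hm hα hp)
    have h2 : Tendsto (meridian N a b hab) (𝓝 (moment N p)) (𝓝 (p : S2)) := by
      have := continuous_meridian.tendsto (f := meridian N a b hab) (moment N p)
      rwa [hγ] at this
    refine h2.frequently ((h1.and_eventually hK).mono fun x hx => ?_)
    exact ⟨⟨meridian N a b hab x, hx.2 hx.1⟩, ⟨x, hx.1, rfl⟩, rfl⟩
  exact closure_minimal hTZ hZ hpT

/-- At a pole, the limits along two orthogonal meridians force the section to vanish. -/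
theorem section_eq_zero_of_pole (hN : 0 < N) (hm : m ∈ polytope N) (hα : 0 < α) {K : Set S2}
    {P : Distribution} {X : ∀ p : K, CTangent (p : S2)} (hX : X ∈ smoothSections K P)
    (hP : ∀ p : S2, moment N p ∈ interior (bumpSet N m α) → P p = realPolarization p)
    (p : K) (hpole : ¬(-1 < (p : S2).1 2 ∧ (p : S2).1 2 < 1)) (hp : moment N p ∈ bumpSet N m α)
    (hK : K ∈ 𝓝 (p : S2)) : X p = 0 := by
  have hev : ∀ (a b : ℝ) (hab : a ^ 2 + b ^ 2 = 1), ∀ᶠ x in 𝓝 (moment N p),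
      x ∈ interior (bumpSet N m α) → meridian N a b hab x ∈ K := by
    intro a b hab
    have h2 := continuous_meridian.tendsto (f := meridian N a b hab) (moment N p)
    rw [meridian_moment_eq_of_pole hN hpole] at h2
    filter_upwards [h2.eventually hK] with x hx _ using hx
  have h0 := cincl_eq_zero_of_meridian (a := 1) (b := 0) (hab := by norm_num) hN hm hα hX hP p
    (meridian_moment_eq_of_pole hN hpole) hp (hev _ _ _)
  have h1 := cincl_eq_zero_of_meridian (a := 0) (b := 1) (hab := by norm_num) hN hm hα hX hP p
    (meridian_moment_eq_of_pole hN hpole) hp (hev _ _ _)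
  refine cincl_injective p ?_
  rw [map_zero]
  funext i
  fin_cases i
  · simpa using h0.1
  · simpa using h1.1
  · exact h0.2

theorem smoothSections_congr {K : Set S2} {P Q : Distribution} {X : ∀ p : K, CTangent (p : S2)}
    (hX : X ∈ smoothSections K P) (h : ∀ p : K, X p ∈ Q p) : X ∈ smoothSections K Q := by
  obtain ⟨A, B, hA, hB, hAB⟩ := hX
  exact ⟨A, B, hA, hB, fun p => ⟨(hAB p).1, h p⟩⟩

theorem mem_of_mem_smoothSections {K : Set S2} {P : Distribution} {X : ∀ p : K, CTangent (p : S2)}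
    (hX : X ∈ smoothSections K P) (p : K) : X p ∈ P p := by
  obtain ⟨A, B, -, -, hAB⟩ := hX
  exact (hAB p).2

/-- On an open set contained in `μ⁻¹(S)`, every point is a pole or lies over the interior of `S`. -/
theorem smoothSections_eq_of_isOpen (hN : 0 < N) (hm : m ∈ polytope N) (hα : 0 < α)
    {P : Distribution}
    (hP : ∀ p : S2, moment N p ∈ interior (bumpSet N m α) → P p = realPolarization p)
    {U : Set S2} (hU : IsOpen U) (hUS : U ⊆ moment N ⁻¹' bumpSet N m α) :
    smoothSections U P = smoothSections U realPolarization := by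
  have hint : ∀ p : U, (-1 < (p : S2).1 2 ∧ (p : S2).1 2 < 1) → P p = realPolarization p :=
    fun p hp => hP p (moment_mem_interior hN hp (mem_of_superset (hU.mem_nhds p.2) hUS))
  ext X
  constructor <;> intro hX <;> refine smoothSections_congr hX fun p => ?_ <;>
    by_cases hp : -1 < (p : S2).1 2 ∧ (p : S2).1 2 < 1
  · rw [← hint p hp]
    exact mem_of_mem_smoothSections hX p
  · rw [section_eq_zero_of_pole hN hm hα hX hP p hp (hUS p.2) (hU.mem_nhds p.2)]
    exact zero_mem _
  · rw [hint p hp]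
    exact mem_of_mem_smoothSections hX p
  · have h0 := mem_of_mem_smoothSections hX p
    rw [realPolarization_eq_bot hp, Submodule.mem_bot] at h0
    rw [h0]
    exact zero_mem _

theorem smoothSections_preimage_bumpSet (hN : 0 < N) (hm : m ∈ polytope N) (hα : 0 < α)
    (hψ : IsOneBump N m α ψ) {P : Distribution}
    (hP : ∀ p : S2, moment N p ∈ interior (bumpSet N m α) → P p = realPolarization p)
    (hP' : ∀ p : S2, moment N p ∉ interior (bumpSet N m α) → P p = kahlerPolarization N ψ 0 p) :
    smoothSections (moment N ⁻¹' bumpSet N m α) P =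
      {X ∈ smoothSections (moment N ⁻¹' bumpSet N m α) realPolarization |
        ∀ p : (moment N ⁻¹' bumpSet N m α : Set S2),
          (p : S2) ∈ frontier (moment N ⁻¹' bumpSet N m α) → X p = 0} := by
  have hint : ∀ p : S2, moment N p ∈ interior (bumpSet N m α) →
      p ∈ interior (moment N ⁻¹' bumpSet N m α) := fun p hp =>
    preimage_interior_subset_interior_preimage continuous_moment hp
  ext X
  constructor
  · intro hX
    have h2 : ∀ p : (moment N ⁻¹' bumpSet N m α : Set S2),
        (-1 < (p : S2).1 2 ∧ (p : S2).1 2 < 1) → cincl p (X p) 2 = 0 := by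
      intro p hp
      obtain ⟨a, b, hab, hγ⟩ := exists_meridian hN hp
      refine (cincl_eq_zero_of_meridian hN hm hα hX hP p hγ p.2
        (Eventually.of_forall fun x hx => ?_)).2
      have hxS := interior_subset hx
      change moment N _ ∈ bumpSet N m α
      rwa [moment_meridian hN hxS.2]
    have h3 : ∀ p : (moment N ⁻¹' bumpSet N m α : Set S2),
        ¬(-1 < (p : S2).1 2 ∧ (p : S2).1 2 < 1) → X p = 0 := fun p hp =>
      section_eq_zero_of_pole hN hm hα hX hP p hp p.2
        (preimage_bumpSet_mem_nhds_of_pole hN hm hα hp p.2)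
    refine ⟨smoothSections_congr hX fun p => ?_, fun p hpf => ?_⟩ <;>
      by_cases hp : -1 < (p : S2).1 2 ∧ (p : S2).1 2 < 1
    · exact (mem_realPolarization_iff hp _).2 (h2 p hp)
    · rw [h3 p hp]
      exact zero_mem _
    · have hn : moment N p ∉ interior (bumpSet N m α) := fun h => hpf.2 (hint p h)
      have hmem := mem_of_mem_smoothSections hX p
      rw [hP' p hn] at hmem
      exact eq_zero_of_mem_kahlerPolarization hN hψ hp hmem (h2 p hp)
    · exact h3 p hp
  · rintro ⟨hX, h0⟩
    refine smoothSections_congr hX fun p => ?_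
    have hmem := mem_of_mem_smoothSections hX p
    by_cases hi : moment N p ∈ interior (bumpSet N m α)
    · rw [hP p hi]
      exact hmem
    · have hz : X p = 0 := by
        by_cases hp : -1 < (p : S2).1 2 ∧ (p : S2).1 2 < 1
        · refine h0 p ⟨subset_closure p.2, fun h => hi ?_⟩
          exact moment_mem_interior hN hp (mem_interior_iff_mem_nhds.1 h)
        · rw [realPolarization_eq_bot hp, Submodule.mem_bot] at hmem
          exact hmem
      rw [hz]
      exact zero_mem _

end Polarizations

end ToricSphere

theorem mainTheorem9 (N : ℕ) (hN : 0 < N) (m α : ℝ) (hm : m ∈ ToricSphere.polytope N)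
    (hα : 0 < α) (ψ : ℝ → ℝ) (hψ : ToricSphere.IsOneBump N m α ψ) :
    ∃ hL : ∀ (s : ℝ≥0) (p : ToricSphere.S2),
        ToricSphere.IsLagrangian ((ToricSphere.symplecticForm N p).baseChange ℂ)
          (ToricSphere.kahlerPolarization N ψ s p),
    ∃ Pinf : ∀ p : ToricSphere.S2, ToricSphere.LagGr N p,
      -- `Pinf` is the pointwise limit in the Lagrangian Grassmannian, and the limit is unique
      (∀ p : ToricSphere.S2,
        Tendsto (fun s : ℝ≥0 =>
            (⟨ToricSphere.kahlerPolarization N ψ s p, hL s p⟩ : ToricSphere.LagGr N p))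
          atTop (𝓝 (Pinf p))) ∧
      (∀ (p : ToricSphere.S2) (Q : ToricSphere.LagGr N p),
        Tendsto (fun s : ℝ≥0 =>
            (⟨ToricSphere.kahlerPolarization N ψ s p, hL s p⟩ : ToricSphere.LagGr N p))
          atTop (𝓝 Q) → Q = Pinf p) ∧
      -- over the interior of `S` it is the real polarization
      (∀ p : ToricSphere.S2, ToricSphere.moment N p ∈ interior (ToricSphere.bumpSet N m α) →
        (Pinf p).space = ToricSphere.realPolarization p) ∧
      -- elsewhere nothing changes
      (∀ p : ToricSphere.S2, ToricSphere.moment N p ∉ interior (ToricSphere.bumpSet N m α) →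
        (∀ s : ℝ≥0,
          ToricSphere.kahlerPolarization N ψ s p = ToricSphere.kahlerPolarization N ψ 0 p) ∧
        (Pinf p).space = ToricSphere.kahlerPolarization N ψ 0 p) ∧
      -- the mixed form at the boundary points of `P` in `S`
      (∀ p : ToricSphere.S2,
        ToricSphere.moment N p ∈
          ToricSphere.bumpSet N m α ∩ frontier (ToricSphere.polytope N) →
        ∀ s : ℝ≥0,
          Disjoint (ToricSphere.realPolarization p) (ToricSphere.vanishingCoordSpan N ψ s p) ∧
          (Pinf p).space =
            ToricSphere.realPolarization p ⊔ ToricSphere.vanishingCoordSpan N ψ s p) ∧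
      -- the smooth sections agree on every open set inside the preimage of `S`
      (∀ U : Set ToricSphere.S2, IsOpen U →
        U ⊆ ToricSphere.moment N ⁻¹' ToricSphere.bumpSet N m α →
        ToricSphere.smoothSections U (fun p => (Pinf p).space) =
          ToricSphere.smoothSections U ToricSphere.realPolarization) ∧
      -- on the whole closed preimage they agree up to vanishing on its topological boundary
      ToricSphere.smoothSections (ToricSphere.moment N ⁻¹' ToricSphere.bumpSet N m α)
          (fun p => (Pinf p).space) =
        {X ∈ ToricSphere.smoothSections (ToricSphere.moment N ⁻¹' ToricSphere.bumpSet N m α)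
            ToricSphere.realPolarization |
          ∀ p : (ToricSphere.moment N ⁻¹' ToricSphere.bumpSet N m α : Set ToricSphere.S2),
            (p : ToricSphere.S2) ∈
            frontier (ToricSphere.moment N ⁻¹' ToricSphere.bumpSet N m α) → X p = 0} := by
  have hPinf : ∀ p : ToricSphere.S2, ∃ Q : ToricSphere.LagGr N p,
      (ToricSphere.moment N p ∈ interior (ToricSphere.bumpSet N m α) →
        Q.space = ToricSphere.realPolarization p) ∧
      (ToricSphere.moment N p ∉ interior (ToricSphere.bumpSet N m α) →
        Q.space = ToricSphere.kahlerPolarization N ψ 0 p) := by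
    intro p
    by_cases h : ToricSphere.moment N p ∈ interior (ToricSphere.bumpSet N m α)
    · exact ⟨⟨_, ToricSphere.isLagrangian_realPolarization hN hψ
        (ToricSphere.height_mem_of_mem_interior hN h)⟩, fun _ => rfl, fun h' => (h' h).elim⟩
    · exact ⟨⟨_, ToricSphere.isLagrangian_kahlerPolarization hN hψ 0 p⟩, fun h' => (h h').elim,
        fun _ => rfl⟩
  choose Pinf hreal hkahler using hPinf
  have hlim : ∀ p : ToricSphere.S2, Tendsto (fun s : ℝ≥0 =>
      (⟨ToricSphere.kahlerPolarization N ψ s p,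
        ToricSphere.isLagrangian_kahlerPolarization hN hψ s p⟩ : ToricSphere.LagGr N p))
      atTop (𝓝 (Pinf p)) := by
    intro p
    by_cases h : ToricSphere.moment N p ∈ interior (ToricSphere.bumpSet N m α)
    · exact ToricSphere.tendsto_kahlerPolarization hN hψ h _ (fun _ => rfl) _ (hreal p h)
    · refine tendsto_const_nhds.congr fun s => ToricSphere.LagrangianGrassmannian.ext ?_
      exact (hkahler p h).trans (ToricSphere.kahlerPolarization_eq_zero hN hψ h s).symm
  have : NeZero N := ⟨hN.ne'⟩
  refine ⟨ToricSphere.isLagrangian_kahlerPolarization hN hψ, Pinf, hlim,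
    fun p Q hQ => tendsto_nhds_unique hQ (hlim p), hreal,
    fun p h => ⟨ToricSphere.kahlerPolarization_eq_zero hN hψ h, hkahler p h⟩, ?_,
    fun U hU hUS => ToricSphere.smoothSections_eq_of_isOpen hN hm hα hreal hU hUS,
    ToricSphere.smoothSections_preimage_bumpSet hN hm hα hψ hreal hkahler⟩
  -- at a pole the real polarization vanishes, so the mixed form is the Kähler polarization itself
  rintro p ⟨-, hp⟩ s
  have hp' : ToricSphere.moment N p ∉ Ioo 0 (N : ℝ) := by
    rw [ToricSphere.polytope, frontier, interior_Icc] at hp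
    exact hp.2
  have hpole : ¬(-1 < p.1 2 ∧ p.1 2 < 1) := by
    rwa [← ToricSphere.moment_mem_Ioo_iff hN]
  have hn : ToricSphere.moment N p ∉ interior (ToricSphere.bumpSet N m α) :=
    fun h => hp' (ToricSphere.mem_interior_bumpSet_iff.1 h).1
  rw [ToricSphere.realPolarization_eq_bot hpole, ToricSphere.vanishingCoordSpan_eq hpole,
    bot_sup_eq, hkahler p hn, ToricSphere.kahlerPolarization_eq_zero hN hψ hn s]
  exact ⟨disjoint_bot_left, rfl⟩
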